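/- There exists a real number $\tau>0$ such that every finite simple graph $G$ that has no induced subgraph isomorphic to the five-vertex cycle $C_5$ satisfies $$\max(\alpha(G),\omega(G))\ge |G|^{\tau},$$ where $|G|$ is the number of vertices of $G$, and $\alpha(G)$ and $\omega(G)$ are the cardinalities of the largest stable (independent) set and the largest clique of $G$, respectively. In other words, $C_5$ has the Erdős–Hajnal property. -/

import Mathlib

/-!
# Graphs without induced five-cycles have the Erdős–Hajnal property

All weights are non-negative functions on the vertices; `edgeWt G w w` is the probability that two
independent `w`-random vertices are adjacent. The theorem follows from a polynomial form of Rödl's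
theorem, `FiveHole.exists_hasWeight`: there are constants `C`, `Λ` such that, for all `s, t ∈ (0,
1]`, every non-empty vertex set `S` carries a probability weight `w ≤ Λ (st)^(-C) / |S|` with
`edgeWt G w w ≤ s` or `edgeWt Gᶜ w w ≤ t`. With `s` and `t` a small negative power of the number
of vertices, a random sample from `w` is a stable set or a clique (`FiveHole.exists_stable`).

Having two independent parameters makes the statement pass through pairwise anticomplete sets
`B_1, …, B_m`: if each `B_i` carries a weight of sparsity `s m`, their average has sparsity `s`.
So a set `S` which is minimal without the required weight, for the parameters `(s, t)`, contains
no `m` pairwise anticomplete sets of size `|S| / m ^ C` (`FiveHole.Critical.no_anticomplete`).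
Also, each subset of `S` of size `|S| / f ^ C` carries a weight of sparsity `s f` *in `G`*, since
the alternative for the complement is excluded (`FiveHole.Critical.exists_weight`).

The five-cycle enters as follows (`FiveHole.Critical.no_comb`). Let `w` be a sparse weight on
neighbours of a vertex `v`, and `Y` a set of non-neighbours of `v`. If the degrees from `w` into
`Y` are large and no vertex of `Y` sees much of `w`, then random vertices `a_1, …, a_m` chosen
according to `w` are pairwise non-adjacent and have large private neighbourhoods `B_i` in `Y`. An
edge between `B_i` and `B_j` would give an induced five-cycle through `v`, `a_i` and `a_j`, so the
`B_i` are pairwise anticomplete, which is impossible in a minimal `S`. Therefore `w` and `Y` can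
be trimmed until hardly any edges run between them (`FiveHole.Critical.exists_trim`).

The usual form of Rödl's theorem (`FiveHole.exists_sparse_or_cosparse`) provides a weight `ν` on
`S` with all degrees at most a small constant `1 / k`, after passing to the complement if
necessary. If some part of `ν` of weight `1 / 2` has all degrees much smaller than `1 / k`, then
`k` can be increased. Otherwise every such part has a vertex with a neighbourhood of size
polynomial in `1 / k`; successive trimmed weights on such neighbourhoods have few edges between
them, and their average contradicts the choice of `S` (`FiveHole.Critical.exists_sparser`). Hence
`k` increases until `ν` itself is a contradiction.
-/

universe u

namespace FiveHole

/-! ### Weights on the vertices -/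

section

open scoped Classical

variable {V : Type*}

/-- The weight function `w`, set to zero outside `Y`. -/
noncomputable def restr (w : V → ℝ) (Y : Finset V) : V → ℝ :=
  fun a => if a ∈ Y then w a else 0

variable {w u : V → ℝ} {S Y : Finset V}

lemma restr_nonneg (hw : ∀ a, 0 ≤ w a) (a : V) : 0 ≤ restr w Y a := by
  unfold restr; split_ifs <;> simp [hw]

lemma restr_le (hw : ∀ a, 0 ≤ w a) (a : V) : restr w Y a ≤ w a := by
  unfold restr; split_ifs <;> simp [hw]

lemma restr_ne_zero {a : V} (h : restr w Y a ≠ 0) : a ∈ Y ∧ w a ≠ 0 := by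
  unfold restr at h
  split_ifs at h with h1
  · exact ⟨h1, h⟩
  · exact absurd rfl h

/-- Markov's inequality for a finite weighted sum. -/
lemma markov {f : V → ℝ} {B T : ℝ} (hw : ∀ a, 0 ≤ w a) (hf : ∀ a, 0 ≤ f a) (Y : Finset V)
    (h : ∑ a ∈ Y, w a * f a ≤ B) : (∑ a ∈ Y with T < f a, w a) * T ≤ B := by
  refine le_trans ?_ h
  rw [Finset.sum_mul]
  refine le_trans (Finset.sum_le_sum (f := fun a => w a * T) (g := fun a => w a * f a) ?_) ?_
  · intro a ha
    exact mul_le_mul_of_nonneg_left (Finset.mem_filter.1 ha).2.le (hw a)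
  · exact Finset.sum_le_sum_of_subset_of_nonneg (Finset.filter_subset _ _)
      fun a _ _ => mul_nonneg (hw a) (hf a)

/-- A set of given weight is large when no vertex has much weight. -/
lemma sum_le_card_mul {c : ℝ} (h : ∀ a, w a ≤ c) (Y : Finset V) :
    ∑ a ∈ Y, w a ≤ (Y.card : ℝ) * c := by
  simpa using Finset.sum_le_card_nsmul Y w c fun a _ => h a

lemma sum_biUnion_le (hw : ∀ a, 0 ≤ w a) (A : Finset V) (B : V → Finset V) :
    ∑ b ∈ A.biUnion B, w b ≤ ∑ a ∈ A, ∑ b ∈ B a, w b := by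
  induction A using Finset.induction_on with
  | empty => simp
  | insert a A ha ih =>
    rw [Finset.biUnion_insert, Finset.sum_insert ha]
    have := Finset.sum_union_inter (s₁ := B a) (s₂ := A.biUnion B) (f := w)
    have h0 : 0 ≤ ∑ b ∈ B a ∩ A.biUnion B, w b := Finset.sum_nonneg fun b _ => hw b
    linarith

variable [Fintype V]

/-- The total `w`-weight of the neighbourhood of `a` in `G`. -/
noncomputable def nbr (G : SimpleGraph V) (w : V → ℝ) (a : V) : ℝ :=
  ∑ b, if G.Adj a b then w b else 0

/-- The product weight `w ⊗ u` of the set of ordered pairs that are adjacent in `G`. -/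
noncomputable def edgeWt (G : SimpleGraph V) (w u : V → ℝ) : ℝ :=
  ∑ a, w a * nbr G u a

/-- `w` is a probability weight carried by `S`. -/
structure ProbOn (w : V → ℝ) (S : Finset V) : Prop where
  nonneg : ∀ a, 0 ≤ w a
  zero : ∀ a, a ∉ S → w a = 0
  sum : ∑ a, w a = 1

variable {G : SimpleGraph V}

lemma nbr_nonneg (hw : ∀ a, 0 ≤ w a) (a : V) : 0 ≤ nbr G w a :=
  Finset.sum_nonneg fun b _ => by split_ifs <;> simp [hw]

lemma nbr_mono (h : ∀ a, w a ≤ u a) (a : V) : nbr G w a ≤ nbr G u a :=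
  Finset.sum_le_sum fun b _ => by split_ifs <;> simp [h]

lemma nbr_le_sum (hw : ∀ a, 0 ≤ w a) (a : V) : nbr G w a ≤ ∑ b, w b :=
  Finset.sum_le_sum fun b _ => by split_ifs <;> simp [hw]

lemma nbr_add (w u : V → ℝ) (a : V) : nbr G (fun x => w x + u x) a = nbr G w a + nbr G u a := by
  simp only [nbr, ← Finset.sum_add_distrib]
  exact Finset.sum_congr rfl fun b _ => by split_ifs <;> simp

lemma nbr_mul (c : ℝ) (w : V → ℝ) (a : V) : nbr G (fun x => c * w x) a = c * nbr G w a := by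
  simp only [nbr, Finset.mul_sum]
  exact Finset.sum_congr rfl fun b _ => by split_ifs <;> simp

lemma nbr_sum {ι : Type*} (A : Finset ι) (w : ι → V → ℝ) (a : V) :
    nbr G (fun x => ∑ i ∈ A, w i x) a = ∑ i ∈ A, nbr G (w i) a := by
  simp only [nbr]
  rw [Finset.sum_comm]
  exact Finset.sum_congr rfl fun b _ => by split_ifs <;> simp

lemma edgeWt_comm (w u : V → ℝ) : edgeWt G w u = edgeWt G u w := by
  simp only [edgeWt, nbr, Finset.mul_sum]
  rw [Finset.sum_comm]
  refine Finset.sum_congr rfl fun b _ => Finset.sum_congr rfl fun a _ => ?_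
  simp only [G.adj_comm b a]
  split_ifs <;> ring

lemma edgeWt_mono {w' u' : V → ℝ} (hw : ∀ a, 0 ≤ w a) (hu : ∀ a, 0 ≤ u a)
    (h : ∀ a, w a ≤ w' a) (h' : ∀ a, u a ≤ u' a) : edgeWt G w u ≤ edgeWt G w' u' :=
  Finset.sum_le_sum fun a _ =>
    mul_le_mul (h a) (nbr_mono h' a) (nbr_nonneg hu a) ((hw a).trans (h a))

lemma edgeWt_mul_mul (c : ℝ) (w : V → ℝ) :
    edgeWt G (fun x => c * w x) (fun x => c * w x) = c ^ 2 * edgeWt G w w := by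
  simp only [edgeWt, nbr_mul, Finset.mul_sum]
  exact Finset.sum_congr rfl fun b _ => by ring

lemma edgeWt_add_self (w u : V → ℝ) :
    edgeWt G (fun x => w x + u x) (fun x => w x + u x) =
      edgeWt G w w + 2 * edgeWt G u w + edgeWt G u u := by
  have h := edgeWt_comm (G := G) u w
  have : edgeWt G (fun x => w x + u x) (fun x => w x + u x) =
      edgeWt G w w + edgeWt G w u + edgeWt G u w + edgeWt G u u := by
    simp only [edgeWt, nbr_add, ← Finset.sum_add_distrib]
    exact Finset.sum_congr rfl fun b _ => by ring
  rw [this, h]; ring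

/-- If every vertex carrying `w` sees little of `u`, then `w ⊗ u` gives edges little weight. -/
lemma edgeWt_le {B : ℝ} (hw : ∀ a, 0 ≤ w a) (h : ∀ a, w a ≠ 0 → nbr G u a ≤ B) :
    edgeWt G w u ≤ (∑ a, w a) * B := by
  rw [edgeWt, Finset.sum_mul]
  refine Finset.sum_le_sum fun a _ => ?_
  by_cases h0 : w a = 0
  · simp [h0]
  · exact mul_le_mul_of_nonneg_left (h a h0) (hw a)

lemma sum_restr (w : V → ℝ) (Y : Finset V) : ∑ a, restr w Y a = ∑ a ∈ Y, w a := by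
  simp [restr]

lemma edgeWt_restr (w ν : V → ℝ) (Y : Finset V) :
    edgeWt G (restr ν Y) w = ∑ y ∈ Y, ν y * nbr G w y := by
  simp [edgeWt, restr]

lemma nbr_restr (w : V → ℝ) (Y : Finset V) (a : V) :
    nbr G (restr w Y) a = ∑ y ∈ Y with G.Adj a y, w y := by
  simp only [nbr, restr, Finset.sum_filter]
  rw [← Finset.sum_subset (Finset.subset_univ Y)]
  · exact Finset.sum_congr rfl fun y hy => by simp [hy]
  · intro y _ hy; simp [hy]

lemma ProbOn.mono (h : ProbOn w S) {T : Finset V} (hST : S ⊆ T) : ProbOn w T :=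
  ⟨h.nonneg, fun a ha => h.zero a fun h' => ha (hST h'), h.sum⟩

lemma ProbOn.mem (h : ProbOn w S) {a : V} (ha : w a ≠ 0) : a ∈ S := by
  by_contra h'; exact ha (h.zero a h')

/-- Dividing a non-zero weight by its total weight makes it a probability weight. -/
lemma probOn_normalize (hw : ∀ a, 0 ≤ w a) (hz : ∀ a, a ∉ S → w a = 0)
    (hs : 0 < ∑ a, w a) : ProbOn (fun a => (∑ a, w a)⁻¹ * w a) S where
  nonneg a := mul_nonneg (inv_nonneg.2 hs.le) (hw a)
  zero a ha := by simp [hz a ha]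
  sum := by rw [← Finset.mul_sum]; exact inv_mul_cancel₀ hs.ne'

/-- If two independent `w`-random vertices are rarely in conflict, then some `M` vertices are
pairwise not in conflict. Reflexivity of the conflict relation keeps the chosen vertices
distinct. -/
lemma exists_conflict_free (hw : ProbOn w S) (R : V → V → Prop) (hsymm : ∀ a b, R a b → R b a)
    (hrefl : ∀ a, w a ≠ 0 → R a a) {p : ℝ} (hp : 0 < p)
    (h : ∑ a, w a * ∑ b with R a b, w b ≤ p) (M : ℕ) (hM : 4 * M * p ≤ 1) :
    ∃ A : Finset V, A.card = M ∧ (∀ a ∈ A, w a ≠ 0) ∧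
      ∀ a ∈ A, ∀ b ∈ A, a ≠ b → ¬ R a b := by
  set r : V → ℝ := fun a => ∑ b with R a b, w b with hr
  have hr0 : ∀ a, 0 ≤ r a := fun a => Finset.sum_nonneg fun b _ => hw.nonneg b
  have hbad : (∑ a with 2 * p < r a, w a) * (2 * p) ≤ p :=
    markov hw.nonneg hr0 Finset.univ h
  have hbad' : ∑ a with 2 * p < r a, w a ≤ 1 / 2 := by nlinarith
  suffices H : ∀ m : ℕ, m ≤ M → ∃ A : Finset V, A.card = m ∧
      (∀ a ∈ A, w a ≠ 0 ∧ r a ≤ 2 * p) ∧ ∀ a ∈ A, ∀ b ∈ A, a ≠ b → ¬ R a b by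
    obtain ⟨A, h1, h2, h3⟩ := H M le_rfl
    exact ⟨A, h1, fun a ha => (h2 a ha).1, h3⟩
  intro m
  induction m with
  | zero => exact fun _ => ⟨∅, by simp⟩
  | succ m ih =>
    intro hm
    obtain ⟨A, h1, h2, h3⟩ := ih (by omega)
    have hforb : ∑ b ∈ A.biUnion (fun a => {b | R a b}), w b ≤ m * (2 * p) := by
      calc ∑ b ∈ A.biUnion (fun a => ({b | R a b} : Finset V)), w b
          ≤ ∑ a ∈ A, ∑ b with R a b, w b :=
            sum_biUnion_le hw.nonneg _ _
        _ ≤ ∑ a ∈ A, 2 * p := Finset.sum_le_sum fun a ha => (h2 a ha).2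
        _ = m * (2 * p) := by simp [h1]
    have hmM : (m : ℝ) + 1 ≤ M := by exact_mod_cast hm
    have hex : ∃ b, w b ≠ 0 ∧ r b ≤ 2 * p ∧ ∀ a ∈ A, ¬ R a b := by
      by_contra hno
      push Not at hno
      have hcov : ∑ b, w b ≤ ∑ a with 2 * p < r a, w a +
          ∑ b ∈ A.biUnion (fun a => ({b | R a b} : Finset V)), w b := by
        have hsub : ∑ b, w b =
            ∑ b ∈ Finset.filter (fun a => 2 * p < r a) Finset.univ ∪
              A.biUnion (fun a => ({b | R a b} : Finset V)), w b := by
          symm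
          refine Finset.sum_subset (Finset.subset_univ _) fun b _ hb => ?_
          by_contra hb0
          simp only [Finset.mem_union, Finset.mem_filter, Finset.mem_univ, true_and,
            Finset.mem_biUnion, not_or, not_lt, not_exists, not_and] at hb
          obtain ⟨a, ha, hab⟩ := hno b hb0 hb.1
          exact hb.2 a ha hab
        rw [hsub, ← Finset.sum_union_inter]
        exact le_add_of_nonneg_right (Finset.sum_nonneg fun b _ => hw.nonneg b)
      rw [hw.sum] at hcov
      nlinarith
    obtain ⟨b, hb0, hbr, hbA⟩ := hex
    have hbnA : b ∉ A := fun hb => hbA b hb (hrefl b hb0)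
    refine ⟨insert b A, by simp [hbnA, h1], ?_, ?_⟩
    · intro a ha
      rcases Finset.mem_insert.1 ha with rfl | ha
      · exact ⟨hb0, hbr⟩
      · exact h2 a ha
    · intro a ha c hc hac
      rcases Finset.mem_insert.1 ha with rfl | ha' <;> rcases Finset.mem_insert.1 hc with rfl | hc'
      · exact absurd rfl hac
      · exact fun hR => hbA c hc' (hsymm _ _ hR)
      · exact hbA a ha'
      · exact h3 a ha' c hc' hac

end

/-! ### Five-cycles and Rödl's theorem -/

section

open scoped Classical

variable {V : Type*}

/-- `G` has no induced five-vertex cycle, spelled out for a cycle `v a x y b`. -/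
def NoFiveHole (G : SimpleGraph V) : Prop :=
  ∀ v a x y b, G.Adj v a → G.Adj a x → G.Adj x y → G.Adj y b → G.Adj b v →
    ¬ G.Adj v x → ¬ G.Adj v y → ¬ G.Adj a y → ¬ G.Adj a b → ¬ G.Adj x b → False

variable {G : SimpleGraph V}

lemma noFiveHole_of_not_isIndContained
    (h : ¬ (SimpleGraph.cycleGraph 5).IsIndContained G) : NoFiveHole G := by
  intro v a x y b h1 h2 h3 h4 h5 n1 n2 n3 n4 n5
  apply h
  have hadj : ∀ i j : Fin 5, G.Adj (![v, a, x, y, b] i) (![v, a, x, y, b] j) ↔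
      (SimpleGraph.cycleGraph 5).Adj i j := by
    intro i j
    fin_cases i <;> fin_cases j <;>
      simp [SimpleGraph.cycleGraph_adj, h1, h2, h3, h4, h5, n1, n2, n3, n4, n5, h1.symm, h2.symm,
        h3.symm, h4.symm, h5.symm, G.adj_comm x v, G.adj_comm y v, G.adj_comm y a,
        G.adj_comm b a, G.adj_comm b x] <;> decide
  -- Distinct vertices of the five-cycle have distinct neighbourhoods, so the map is injective.
  have hsep : ∀ i j : Fin 5, i ≠ j → ∃ k, (SimpleGraph.cycleGraph 5).Adj i k ∧
      ¬ (SimpleGraph.cycleGraph 5).Adj j k := by decide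
  refine ⟨⟨⟨![v, a, x, y, b], fun i j hij => ?_⟩, fun {i j} => hadj i j⟩⟩
  by_contra hne
  obtain ⟨k, hk1, hk2⟩ := hsep i j hne
  rw [← hadj] at hk1 hk2
  rw [hij] at hk1
  exact hk2 hk1

/-- The complement of a five-cycle is a five-cycle. -/
lemma NoFiveHole.compl (h : NoFiveHole G) : NoFiveHole Gᶜ := by
  intro v a x y b h1 h2 h3 h4 h5 n1 n2 n3 n4 n5
  have key : ∀ {p q r : V}, ¬ Gᶜ.Adj p q → Gᶜ.Adj q r → ¬ Gᶜ.Adj p r → G.Adj p q := by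
    intro p q r hpq hqr hpr
    by_contra hG
    refine hpq ((SimpleGraph.compl_adj _ _ _).2 ⟨fun hpq' => ?_, hG⟩)
    subst hpq'
    exact hpr hqr
  have g1 : G.Adj v x := key n1 h3 n2
  have g2 : G.Adj v y := key n2 h3.symm n1
  have g3 : G.Adj a y := key n3 h4 n4
  have g4 : G.Adj a b := key n4 h4.symm n3
  have g5 : G.Adj x b := key n5 h5 fun hxv => n1 hxv.symm
  have nn : ∀ {p q : V}, Gᶜ.Adj p q → ¬ G.Adj p q := fun hpq =>
    ((SimpleGraph.compl_adj _ _ _).1 hpq).2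
  exact h v x b a y g1 g5 g4.symm g3 g2.symm (nn h5.symm) (nn h1) (nn h2.symm) (nn h3)
    (nn h4.symm)

/-- The vertices of `W` that are adjacent to `v` in `H`. -/
noncomputable def nbhdIn (H : SimpleGraph V) (W : Finset V) (v : V) : Finset V :=
  {b ∈ W | H.Adj v b}

lemma mem_nbhdIn {H : SimpleGraph V} {W : Finset V} {v b : V} :
    b ∈ nbhdIn H W v ↔ b ∈ W ∧ H.Adj v b := Finset.mem_filter

variable [Fintype V]

/-- A graph without induced five-cycles has two large sets `A`, `B` such that every vertex of `A`
has few neighbours in `B`, in the graph or in its complement. Otherwise a five-cycle can be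
embedded greedily, keeping at each step a large set of candidates for each remaining vertex. -/
lemma exists_sparse_pair (hG : NoFiveHole G) {ξ : ℝ} (h0 : 0 < ξ) (h1 : ξ ≤ 1) (S : Finset V)
    (hS : S.Nonempty) :
    ∃ A ⊆ S, ∃ B ⊆ S, ξ ^ 4 / 3 * S.card ≤ A.card ∧ ξ ^ 4 / 3 * S.card ≤ B.card ∧
      ((∀ a ∈ A, ((nbhdIn G B a).card : ℝ) ≤ ξ * B.card) ∨
        ∀ a ∈ A, ((nbhdIn Gᶜ B a).card : ℝ) ≤ ξ * B.card) := by
  by_contra hno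
  push Not at hno
  set n : ℝ := (S.card : ℝ) with hn
  have hn0 : 0 < n := by rw [hn]; exact_mod_cast hS.card_pos
  set δ : ℝ := ξ ^ 4 / 3 with hδ
  have e2 : ξ ^ 2 ≤ ξ := by nlinarith
  have e3 : ξ ^ 3 ≤ ξ ^ 2 := by nlinarith [pow_pos h0 2]
  have e4 : ξ ^ 4 ≤ ξ ^ 3 := by nlinarith [pow_pos h0 3]
  have hδ0 : 0 < δ := by positivity
  -- Few vertices of `U` have a small neighbourhood in `W`.
  have hbad : ∀ H : SimpleGraph V, (H = G ∨ H = Gᶜ) → ∀ U ⊆ S, ∀ W ⊆ S, δ * n ≤ W.card →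
      (({u ∈ U | ((nbhdIn H W u).card : ℝ) ≤ ξ * W.card} : Finset V).card : ℝ) < δ * n := by
    intro H hH U hU W hW hWc
    by_contra hlt
    push Not at hlt
    obtain ⟨⟨a, ha, ha'⟩, ⟨b, hb, hb'⟩⟩ :=
      hno _ ((Finset.filter_subset _ U).trans hU) W hW hlt hWc
    rcases hH with rfl | rfl
    · exact absurd (Finset.mem_filter.1 ha).2 (not_le.2 ha')
    · exact absurd (Finset.mem_filter.1 hb).2 (not_le.2 hb')
  -- Hence `U` has a vertex with large neighbourhoods in three prescribed sets.
  have hpick : ∀ U ⊆ S, 3 * δ * n ≤ U.card →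
      ∀ H₁ H₂ H₃ : SimpleGraph V, (H₁ = G ∨ H₁ = Gᶜ) → (H₂ = G ∨ H₂ = Gᶜ) → (H₃ = G ∨ H₃ = Gᶜ) →
      ∀ W₁ ⊆ S, ∀ W₂ ⊆ S, ∀ W₃ ⊆ S, δ * n ≤ W₁.card → δ * n ≤ W₂.card → δ * n ≤ W₃.card →
      ∃ u ∈ U, ξ * W₁.card < (nbhdIn H₁ W₁ u).card ∧ ξ * W₂.card < (nbhdIn H₂ W₂ u).card ∧
        ξ * W₃.card < (nbhdIn H₃ W₃ u).card := by
    intro U hU hUc H₁ H₂ H₃ k1 k2 k3 W₁ s1 W₂ s2 W₃ s3 c1 c2 c3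
    by_contra hcon
    push Not at hcon
    have hsub : U ⊆ {u ∈ U | ((nbhdIn H₁ W₁ u).card : ℝ) ≤ ξ * W₁.card} ∪
        ({u ∈ U | ((nbhdIn H₂ W₂ u).card : ℝ) ≤ ξ * W₂.card} ∪
        {u ∈ U | ((nbhdIn H₃ W₃ u).card : ℝ) ≤ ξ * W₃.card}) := by
      intro u hu
      simp only [Finset.mem_union, Finset.mem_filter, hu, true_and]
      by_cases q1 : ((nbhdIn H₁ W₁ u).card : ℝ) ≤ ξ * W₁.card
      · exact Or.inl q1
      · by_cases q2 : ((nbhdIn H₂ W₂ u).card : ℝ) ≤ ξ * W₂.card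
        · exact Or.inr (Or.inl q2)
        · exact Or.inr (Or.inr (hcon u hu (not_le.1 q1) (not_le.1 q2)))
    have hc := (Finset.card_le_card hsub).trans ((Finset.card_union_le _ _).trans
      (Nat.add_le_add_left (Finset.card_union_le _ _) _))
    have hc' : (U.card : ℝ) ≤ _ := Nat.cast_le.2 hc
    push_cast at hc'
    linarith [hbad H₁ k1 U hU W₁ s1 c1, hbad H₂ k2 U hU W₂ s2 c2, hbad H₃ k3 U hU W₃ s3 c3]
  have sub : ∀ {H : SimpleGraph V} {W : Finset V} {v : V}, W ⊆ S → nbhdIn H W v ⊆ S :=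
    fun h => (Finset.filter_subset _ _).trans h
  have q0 : 3 * δ * n ≤ n := by rw [hδ]; nlinarith
  have q1 : 3 * δ * n ≤ ξ * n := by rw [hδ]; nlinarith
  have q2 : 3 * δ * n ≤ ξ ^ 2 * n := by rw [hδ]; nlinarith
  have q3 : 3 * δ * n ≤ ξ ^ 3 * n := by rw [hδ]; nlinarith
  have pd : 0 < δ * n := mul_pos hδ0 hn0
  have hlG : G = G ∨ G = Gᶜ := Or.inl rfl
  have hlC : Gᶜ = G ∨ Gᶜ = Gᶜ := Or.inr rfl
  obtain ⟨v, -, v1, v2, -⟩ := hpick S subset_rfl (by linarith) G Gᶜ G hlG hlC hlG S subset_rfl S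
    subset_rfl S subset_rfl (by linarith) (by linarith) (by linarith)
  set N := nbhdIn G S v
  set Z := nbhdIn Gᶜ S v
  have sN : N ⊆ S := sub subset_rfl
  have sZ : Z ⊆ S := sub subset_rfl
  obtain ⟨a, ha, a1, a2, a3⟩ := hpick N sN (by linarith) G Gᶜ Gᶜ hlG hlC hlC
    Z sZ Z sZ N sN (by linarith) (by linarith) (by linarith)
  set X := nbhdIn G Z a
  set Y := nbhdIn Gᶜ Z a
  set B := nbhdIn Gᶜ N a
  have cX : ξ ^ 2 * n ≤ X.card := by nlinarith
  have cY : ξ ^ 2 * n ≤ Y.card := by nlinarith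
  have cB : ξ ^ 2 * n ≤ B.card := by nlinarith
  obtain ⟨x, hx, x1, x2, -⟩ := hpick X (sub sZ) (by linarith) G Gᶜ Gᶜ hlG hlC hlC
    Y (sub sZ) B (sub sN) B (sub sN) (by linarith) (by linarith) (by linarith)
  set Y' := nbhdIn G Y x
  set B' := nbhdIn Gᶜ B x
  have cY' : ξ ^ 3 * n ≤ Y'.card := by nlinarith
  have cB' : ξ ^ 3 * n ≤ B'.card := by nlinarith
  obtain ⟨y, hy, y1, -, -⟩ := hpick Y' (sub (sub sZ)) (by linarith) G G G hlG hlG hlG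
    B' (sub (sub sN)) B' (sub (sub sN)) B' (sub (sub sN)) (by linarith) (by linarith) (by linarith)
  have hpos : (0 : ℝ) < (nbhdIn G B' y).card := by
    exact lt_of_le_of_lt (mul_nonneg h0.le (Nat.cast_nonneg _)) y1
  obtain ⟨b, hb⟩ := Finset.card_pos.1 (Nat.cast_pos.1 hpos)
  obtain ⟨hb1, hyb⟩ := mem_nbhdIn.1 hb
  obtain ⟨hb2, hxb⟩ := mem_nbhdIn.1 hb1
  obtain ⟨hb3, hab⟩ := mem_nbhdIn.1 hb2
  obtain ⟨hb4, hvb⟩ := mem_nbhdIn.1 hb3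
  obtain ⟨hy2, hxy⟩ := mem_nbhdIn.1 hy
  obtain ⟨hy3, hay⟩ := mem_nbhdIn.1 hy2
  obtain ⟨hy4, hvy⟩ := mem_nbhdIn.1 hy3
  obtain ⟨hx2, hax⟩ := mem_nbhdIn.1 hx
  obtain ⟨hx3, hvx⟩ := mem_nbhdIn.1 hx2
  obtain ⟨ha2, hva⟩ := mem_nbhdIn.1 ha
  exact hG v a x y b hva hax hxy hyb hvb.symm hvx.2 hvy.2 hay.2 hab.2 hxb.2

/-- Two sparse probability weights with few edges between them average to a sparser one. The weight
on `B` is chosen after the weight on `A`, among the vertices that see little of the latter, so the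
sparsity between the two does not depend on how concentrated they are. -/
lemma exists_sparser_weight {H : SimpleGraph V} {M σ ξ δ : ℝ} {P : (V → ℝ) → Prop}
    (hξ : 0 < ξ) (hξσ : ξ ≤ σ / 4) (hδ : 0 < δ)
    (hQ : ∀ S : Finset V, S.Nonempty → ∃ w, ProbOn w S ∧ (∀ a, w a * S.card ≤ M) ∧
      (edgeWt H w w ≤ σ ∨ P w))
    {S A B : Finset V} (hS : S.Nonempty) (hA : A ⊆ S) (hB : B ⊆ S)
    (hAc : δ * S.card ≤ A.card) (hBc : δ * S.card ≤ B.card)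
    (hAB : ∀ a ∈ A, ((nbhdIn H B a).card : ℝ) ≤ ξ * B.card) :
    ∃ w, ProbOn w S ∧ (∀ a, w a * S.card ≤ 2 * M / δ) ∧ (edgeWt H w w ≤ 3 / 4 * σ ∨ P w) := by
  have hSc : (0 : ℝ) < S.card := by exact_mod_cast hS.card_pos
  have hδS := mul_pos hδ hSc
  have hAc0 : (0 : ℝ) < A.card := by linarith
  have hBc0 : (0 : ℝ) < B.card := by linarith
  -- A weight bounded on a subset of relative size `δ / 2` is bounded on `S`.
  have hbd : ∀ (T : Finset V) (w : V → ℝ), (∀ a, 0 ≤ w a) → δ * S.card ≤ 2 * T.card →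
      (∀ a, w a * T.card ≤ M) → ∀ a, w a * S.card ≤ 2 * M / δ := by
    intro T w hw hT hwT a
    rw [le_div_iff₀ hδ]
    nlinarith [hwT a, mul_le_mul_of_nonneg_left hT (hw a)]
  obtain ⟨w, hw, hwM, hwE⟩ := hQ A (Finset.card_pos.1 (Nat.cast_pos.1 hAc0))
  have hwS := hbd A w hw.nonneg (by linarith) hwM
  rcases hwE with hwE | hwP
  swap
  · exact ⟨w, hw.mono hA, hwS, Or.inr hwP⟩
  set B' : Finset V := B \ {b ∈ B | 2 * ξ < nbr H w b} with hB'
  have hcross : ∑ b ∈ B, (1 : ℝ) * nbr H w b ≤ ξ * B.card := by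
    have h1 : ∑ b ∈ B, (1 : ℝ) * nbr H w b = edgeWt H w (restr (fun _ => 1) B) := by
      rw [edgeWt_comm, edgeWt_restr]
    rw [h1]
    refine (edgeWt_le (B := ξ * B.card) hw.nonneg fun a ha => ?_).trans (by rw [hw.sum, one_mul])
    rw [nbr_restr]
    simpa [nbhdIn] using hAB a (hw.mem ha)
  have hbad := markov (T := 2 * ξ) (fun _ => zero_le_one) (nbr_nonneg hw.nonneg) B hcross
  have hbad' : 2 * (({b ∈ B | 2 * ξ < nbr H w b} : Finset V).card : ℝ) ≤ B.card := by
    rw [Finset.sum_const, nsmul_eq_mul, mul_one] at hbad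
    nlinarith
  have hB'c : (B.card : ℝ) ≤ 2 * B'.card := by
    have := Finset.card_sdiff_add_card_eq_card
      (Finset.filter_subset (fun b => 2 * ξ < nbr H w b) B)
    have h2 : (B'.card : ℝ) + ({b ∈ B | 2 * ξ < nbr H w b} : Finset V).card = B.card := by
      exact_mod_cast this
    linarith
  have hB'S : B' ⊆ S := Finset.sdiff_subset.trans hB
  have hB'0 : (0 : ℝ) < B'.card := by linarith
  obtain ⟨u, hu, huM, huE⟩ := hQ B' (Finset.card_pos.1 (Nat.cast_pos.1 hB'0))
  have huS := hbd B' u hu.nonneg (by linarith) huM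
  rcases huE with huE | huP
  swap
  · exact ⟨u, hu.mono hB'S, huS, Or.inr huP⟩
  have hwu : edgeWt H u w ≤ 2 * ξ := by
    refine (edgeWt_le (B := 2 * ξ) hu.nonneg fun b hb => ?_).trans (by rw [hu.sum, one_mul])
    have := hu.mem hb
    rw [hB', Finset.mem_sdiff, Finset.mem_filter, not_and] at this
    exact not_lt.1 (this.2 this.1)
  refine ⟨fun a => 1 / 2 * (w a + u a), ⟨fun a => ?_, fun a ha => ?_, ?_⟩, fun a => ?_, Or.inl ?_⟩
  · have := hw.nonneg a; have := hu.nonneg a; positivity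
  · rw [(hw.mono hA).zero a ha, (hu.mono hB'S).zero a ha]; norm_num
  · rw [← Finset.mul_sum, Finset.sum_add_distrib, hw.sum, hu.sum]; norm_num
  · linarith [hwS a, huS a]
  · rw [edgeWt_mul_mul, edgeWt_add_self]
    linarith

end

/-- Rödl's theorem for graphs without induced five-cycles, in a weighted form: some probability
weight that is not too concentrated, with a bound depending on `ε` only, is `ε`-sparse in the graph
or in its complement. The sparsities in the graph and in the complement are improved in turn. -/
theorem exists_sparse_or_cosparse {ε : ℝ} (hε : 0 < ε) :
    ∃ M : ℝ, ∀ (V : Type u) [Fintype V] (G : SimpleGraph V), NoFiveHole G →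
      ∀ S : Finset V, S.Nonempty → ∃ w, ProbOn w S ∧ (∀ a, w a * S.card ≤ M) ∧
        (edgeWt G w w ≤ ε ∨ edgeWt Gᶜ w w ≤ ε) := by
  have hunif : ∀ (V : Type u) [Fintype V] (S : Finset V), S.Nonempty → ∃ w, ProbOn w S ∧
      (∀ a, w a * S.card ≤ 1) ∧ ∀ G : SimpleGraph V, edgeWt G w w ≤ 1 := by
    classical
    intro V _ S hS
    have hSc : (0 : ℝ) < S.card := by exact_mod_cast hS.card_pos
    have hprob : ProbOn (fun a => if a ∈ S then (S.card : ℝ)⁻¹ else 0) S := by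
      refine ⟨fun a => by split_ifs <;> positivity, fun a ha => by simp [ha], ?_⟩
      rw [Finset.sum_ite_mem, Finset.univ_inter, Finset.sum_const, nsmul_eq_mul,
        mul_inv_cancel₀ hSc.ne']
    refine ⟨_, hprob, fun a => ?_, fun G => ?_⟩
    · split_ifs
      · rw [inv_mul_cancel₀ hSc.ne']
      · simp
    · refine (edgeWt_le (B := 1) hprob.nonneg fun a _ => ?_).trans (by rw [hprob.sum, one_mul])
      exact (nbr_le_sum hprob.nonneg a).trans hprob.sum.le
  have key : ∀ m i j : ℕ, i + j = m → ∃ M : ℝ, ∀ (V : Type u) [Fintype V] (G : SimpleGraph V),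
      NoFiveHole G → ∀ S : Finset V, S.Nonempty → ∃ w, ProbOn w S ∧ (∀ a, w a * S.card ≤ M) ∧
        (edgeWt G w w ≤ (3 / 4) ^ i ∨ edgeWt Gᶜ w w ≤ (3 / 4) ^ j) := by
    intro m
    induction m with
    | zero =>
      intro i j hij
      refine ⟨1, fun V _ G _ S hS => ?_⟩
      obtain ⟨w, h1, h2, h3⟩ := hunif V S hS
      have hi : i = 0 := by omega
      exact ⟨w, h1, h2, Or.inl (by simpa [hi] using h3 G)⟩
    | succ m ih =>
      intro i j hij
      rcases Nat.eq_zero_or_pos i with hi | hi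
      · refine ⟨1, fun V _ G _ S hS => ?_⟩
        obtain ⟨w, h1, h2, h3⟩ := hunif V S hS
        exact ⟨w, h1, h2, Or.inl (by simpa [hi] using h3 G)⟩
      rcases Nat.eq_zero_or_pos j with hj | hj
      · refine ⟨1, fun V _ G _ S hS => ?_⟩
        obtain ⟨w, h1, h2, h3⟩ := hunif V S hS
        exact ⟨w, h1, h2, Or.inr (by simpa [hj] using h3 Gᶜ)⟩
      obtain ⟨i, rfl⟩ : ∃ i', i = i' + 1 := ⟨i - 1, by omega⟩
      obtain ⟨j, rfl⟩ : ∃ j', j = j' + 1 := ⟨j - 1, by omega⟩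
      obtain ⟨M₁, hM₁⟩ := ih i (j + 1) (by omega)
      obtain ⟨M₂, hM₂⟩ := ih (i + 1) j (by omega)
      obtain ⟨ξ, hξ0, hξ1, hξi, hξj⟩ : ∃ ξ : ℝ, 0 < ξ ∧ ξ ≤ 1 ∧ ξ ≤ (3 / 4) ^ i / 4 ∧
          ξ ≤ (3 / 4) ^ j / 4 :=
        ⟨min 1 (min ((3 / 4) ^ i / 4) ((3 / 4) ^ j / 4)), by positivity, min_le_left _ _,
          (min_le_right _ _).trans (min_le_left _ _), (min_le_right _ _).trans (min_le_right _ _)⟩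
      have hδ : 0 < ξ ^ 4 / 3 := by positivity
      refine ⟨max (2 * M₁ / (ξ ^ 4 / 3)) (2 * M₂ / (ξ ^ 4 / 3)), fun V _ G hG S hS => ?_⟩
      obtain ⟨A, hA, B, hB, hAc, hBc, hAB | hAB⟩ := exists_sparse_pair hG hξ0 hξ1 S hS
      · obtain ⟨w, h1, h2, h3⟩ := exists_sparser_weight (H := G) hξ0 hξi hδ (hM₁ V G hG) hS hA hB
          hAc hBc hAB
        exact ⟨w, h1, fun a => (h2 a).trans (le_max_left _ _), by rwa [pow_succ']⟩
      · obtain ⟨w, h1, h2, h3⟩ := exists_sparser_weight (H := Gᶜ) hξ0 hξj hδ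
          (fun S hS => by simpa only [or_comm] using hM₂ V G hG S hS) hS hA hB hAc hBc hAB
        refine ⟨w, h1, fun a => (h2 a).trans (le_max_right _ _), ?_⟩
        rw [pow_succ' _ j]
        exact h3.symm
  obtain ⟨k, hk⟩ := exists_pow_lt_of_lt_one hε (by norm_num : (3 / 4 : ℝ) < 1)
  obtain ⟨M, hM⟩ := key (k + k) k k rfl
  refine ⟨M, fun V _ G hG S hS => ?_⟩
  obtain ⟨w, h1, h2, h3⟩ := hM V G hG S hS
  exact ⟨w, h1, h2, h3.imp (fun h => h.trans hk.le) fun h => h.trans hk.le⟩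

/-! ### Critical sets and combs -/

section

open scoped Classical

variable {V : Type*} [Fintype V]

/-- Some probability weight on `S`, at most `Λ / ((s * t) ^ C * |S|)` everywhere, gives the edges
of `G` weight at most `s` or the edges of the complement weight at most `t`. -/
def HasWeight (G : SimpleGraph V) (C : ℕ) (Λ : ℝ) (S : Finset V) (s t : ℝ) : Prop :=
  ∃ w, ProbOn w S ∧ (∀ a, w a * ((s * t) ^ C * S.card) ≤ Λ) ∧
    (edgeWt G w w ≤ s ∨ edgeWt Gᶜ w w ≤ t)

/-- `S` has no weight as in `HasWeight` for the sparsities `s` and `t`, whereas every smaller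
non-empty subset has one for all pairs of sparsities. -/
structure Critical (G : SimpleGraph V) (C : ℕ) (Λ : ℝ) (S : Finset V) (s t : ℝ) : Prop where
  s_pos : 0 < s
  s_le : s ≤ 1
  t_pos : 0 < t
  t_le : t ≤ 1
  nonempty : S.Nonempty
  ih : ∀ T ⊆ S, T.Nonempty → T.card < S.card → ∀ s' t' : ℝ, 0 < s' → s' ≤ 1 → 0 < t' → t' ≤ 1 →
    HasWeight G C Λ T s' t'
  fail : ¬ HasWeight G C Λ S s t

variable {G : SimpleGraph V} {C : ℕ} {Λ : ℝ} {S : Finset V} {s t : ℝ}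

lemma HasWeight.compl (h : HasWeight G C Λ S s t) : HasWeight Gᶜ C Λ S t s := by
  obtain ⟨w, h1, h2, h3⟩ := h
  exact ⟨w, h1, by rwa [mul_comm t s], by rwa [compl_compl, or_comm]⟩

lemma Critical.compl (h : Critical G C Λ S s t) : Critical Gᶜ C Λ S t s where
  s_pos := h.t_pos
  s_le := h.t_le
  t_pos := h.s_pos
  t_le := h.s_le
  nonempty := h.nonempty
  ih T hT h0 hc s' t' h1 h2 h3 h4 := (h.ih T hT h0 hc t' s' h3 h4 h1 h2).compl
  fail h' := h.fail (by simpa using h'.compl)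

/-- The bound on the weight of a vertex in `HasWeight`. -/
noncomputable def cap (C : ℕ) (Λ : ℝ) (S : Finset V) (s t : ℝ) : ℝ :=
  Λ / ((s * t) ^ C * S.card)

lemma Critical.card_pos (h : Critical G C Λ S s t) : (0 : ℝ) < S.card := by
  exact_mod_cast h.nonempty.card_pos

lemma Critical.den_pos (h : Critical G C Λ S s t) : 0 < (s * t) ^ C * (S.card : ℝ) :=
  mul_pos (pow_pos (mul_pos h.s_pos h.t_pos) _) h.card_pos

lemma Critical.lt_edgeWt (h : Critical G C Λ S s t) {w : V → ℝ} (hw : ProbOn w S)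
    (hc : ∀ a, w a ≤ cap C Λ S s t) : s < edgeWt G w w ∧ t < edgeWt Gᶜ w w := by
  have hc' : ∀ a, w a * ((s * t) ^ C * S.card) ≤ Λ := fun a => (le_div_iff₀ h.den_pos).1 (hc a)
  constructor
  · by_contra hle
    exact h.fail ⟨w, hw, hc', Or.inl (not_lt.1 hle)⟩
  · by_contra hle
    exact h.fail ⟨w, hw, hc', Or.inr (not_lt.1 hle)⟩

/-- A subset of a critical set carries a weight that is sparse in `G`, not only in `G` or in its
complement, where the sparsity is worse than `s` only by a factor `f` of which the `C`-th power
makes up for the small size of the subset. -/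
lemma Critical.exists_weight (h : Critical G C Λ S s t) (hΛ : 0 < Λ) {T : Finset V} (hT : T ⊆ S)
    (hTc : T.card < S.card) {f L : ℝ} (hf : 0 < f) (hsf : s * f ≤ 1) (hL : 1 ≤ L)
    (hfT : L * S.card ≤ f ^ C * T.card) :
    ∃ w, ProbOn w T ∧ (∀ a, w a ≤ cap C Λ S s t / L) ∧ edgeWt G w w ≤ s * f := by
  have hL0 : 0 < L := by linarith
  have hTc0 : (0 : ℝ) < T.card := by
    have h1 : 0 < f ^ C * (T.card : ℝ) := lt_of_lt_of_le (mul_pos hL0 h.card_pos) hfT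
    exact pos_of_mul_pos_right h1 (pow_pos hf C).le
  obtain ⟨w, hw, hwb, hwE⟩ := h.ih T hT (Finset.card_pos.1 (Nat.cast_pos.1 hTc0)) hTc (s * f) t
    (mul_pos h.s_pos hf) hsf h.t_pos h.t_le
  have hcap : ∀ a, w a ≤ cap C Λ S s t / L := by
    intro a
    rw [cap, div_div, le_div_iff₀ (mul_pos h.den_pos hL0)]
    refine le_trans (mul_le_mul_of_nonneg_left ?_ (hw.nonneg a)) (hwb a)
    calc (s * t) ^ C * S.card * L = (s * t) ^ C * (L * S.card) := by ring
      _ ≤ (s * t) ^ C * (f ^ C * T.card) :=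
        mul_le_mul_of_nonneg_left hfT (pow_pos (mul_pos h.s_pos h.t_pos) _).le
      _ = (s * f * t) ^ C * T.card := by rw [← mul_assoc, ← mul_pow]; ring
  refine ⟨w, hw, hcap, hwE.resolve_right fun hE => ?_⟩
  have hcap0 : 0 ≤ cap C Λ S s t := (div_pos hΛ h.den_pos).le
  exact absurd hE (not_le.2 (h.lt_edgeWt (hw.mono hT)
    fun a => (hcap a).trans (div_le_self hcap0 hL)).2)

/-- A critical set has no collection of large pairwise anticomplete subsets. -/
lemma Critical.no_anticomplete (h : Critical G C Λ S s t) (hΛ : 0 < Λ) {A : Finset V}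
    (hA : A.Nonempty) {B : V → Finset V} (hB : ∀ a ∈ A, B a ⊆ S)
    (hBc : ∀ a ∈ A, (B a).card < S.card) (hsA : s * A.card ≤ 1)
    (hAB : ∀ a ∈ A, (S.card : ℝ) ≤ (A.card : ℝ) ^ C * (B a).card)
    (hanti : ∀ a ∈ A, ∀ b ∈ A, a ≠ b → ∀ x ∈ B a, ∀ y ∈ B b, ¬ G.Adj x y) : False := by
  have hA0 : (0 : ℝ) < A.card := by exact_mod_cast hA.card_pos
  have hex : ∀ a, ∃ w, a ∈ A → ProbOn w (B a) ∧ (∀ x, w x ≤ cap C Λ S s t) ∧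
      edgeWt G w w ≤ s * A.card := by
    intro a
    by_cases ha : a ∈ A
    · obtain ⟨w, h1, h2, h3⟩ := h.exists_weight hΛ (hB a ha) (hBc a ha) hA0 hsA le_rfl
        (by simpa using hAB a ha)
      exact ⟨w, fun _ => ⟨h1, by simpa using h2, h3⟩⟩
    · exact ⟨0, fun ha' => absurd ha' ha⟩
  choose w hw using hex
  have hcross : ∀ a ∈ A, ∀ b ∈ A, a ≠ b → edgeWt G (w a) (w b) = 0 := by
    intro a ha b hb hab
    refine Finset.sum_eq_zero fun x _ => ?_
    by_cases hx : w a x = 0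
    · simp [hx]
    refine mul_eq_zero_of_right _ (Finset.sum_eq_zero fun y _ => ?_)
    by_cases hy : w b y = 0
    · simp [hy]
    rw [if_neg (hanti a ha b hb hab x ((hw a ha).1.mem hx) y ((hw b hb).1.mem hy))]
  have hE : edgeWt G (fun x => ∑ a ∈ A, w a x) (fun x => ∑ a ∈ A, w a x) =
      ∑ a ∈ A, edgeWt G (w a) (w a) := by
    have h1 : edgeWt G (fun x => ∑ a ∈ A, w a x) (fun x => ∑ a ∈ A, w a x) =
        ∑ a ∈ A, ∑ b ∈ A, edgeWt G (w a) (w b) := by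
      simp only [edgeWt, nbr_sum, Finset.sum_mul_sum]
      rw [Finset.sum_comm]
      refine Finset.sum_congr rfl fun a _ => ?_
      rw [Finset.sum_comm]
    rw [h1]
    refine Finset.sum_congr rfl fun a ha => ?_
    rw [Finset.sum_eq_single a (fun b hb hba => hcross a ha b hb hba.symm)
      (fun ha' => absurd ha ha')]
  have hprob : ProbOn (fun x => (A.card : ℝ)⁻¹ * ∑ a ∈ A, w a x) S := by
    refine ⟨fun x => mul_nonneg (inv_nonneg.2 hA0.le)
      (Finset.sum_nonneg fun a ha => (hw a ha).1.nonneg x), fun x hx => ?_, ?_⟩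
    · rw [Finset.sum_eq_zero fun a ha => ((hw a ha).1.mono (hB a ha)).zero x hx, mul_zero]
    · rw [← Finset.mul_sum, Finset.sum_comm, Finset.sum_congr rfl fun a ha => (hw a ha).1.sum]
      simp [hA0.ne']
  have hlt := (h.lt_edgeWt hprob fun x => ?_).1
  · rw [edgeWt_mul_mul, hE] at hlt
    have hsum : ∑ a ∈ A, edgeWt G (w a) (w a) ≤ A.card * (s * A.card) := by
      simpa using Finset.sum_le_card_nsmul A _ _ fun a ha => (hw a ha).2.2
    have : (A.card : ℝ)⁻¹ ^ 2 * ∑ a ∈ A, edgeWt G (w a) (w a) ≤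
        (A.card : ℝ)⁻¹ ^ 2 * (A.card * (s * A.card)) :=
      mul_le_mul_of_nonneg_left hsum (by positivity)
    have h2 : (A.card : ℝ)⁻¹ ^ 2 * (A.card * (s * A.card)) = s := by field_simp
    linarith
  · have hsum : ∑ a ∈ A, w a x ≤ A.card * cap C Λ S s t := by
      simpa using Finset.sum_le_card_nsmul A _ _ fun a ha => (hw a ha).2.1 x
    rw [inv_mul_le_iff₀ hA0]
    exact hsum

/-- A critical set has no comb: no weight `u` on the neighbours of a vertex `v` that is sparse,
spread over the non-neighbours `Y` of `v`, and for which all degrees into `Y` are large. Random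
vertices chosen according to `u` are pairwise non-adjacent and have large private neighbourhoods in
`Y`; an edge between two of these would complete an induced five-cycle through `v`. -/
lemma Critical.no_comb (h : Critical G C Λ S s t) (hΛ : 0 < Λ) (hG : NoFiveHole G) {D : ℕ}
    (hC : 42 + 20 * D ≤ C) {z : ℝ} (hz : 64 ≤ z) (hs : s < 32 / z ^ 18) {ν : V → ℝ}
    (hν : ∀ a, 0 ≤ ν a) (hνb : ∀ a, ν a * S.card ≤ z ^ (20 * D)) {v : V} {X Y : Finset V}
    (hXS : X ⊆ S) (hX : ∀ a ∈ X, G.Adj v a) (hYS : Y ⊆ S) (hY : ∀ y ∈ Y, ¬ G.Adj v y) {u : V → ℝ}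
    (hu : ProbOn u X) (huE : edgeWt G u u ≤ s * z ^ 5) (huY : ∀ y ∈ Y, nbr G u y ≤ 1 / z ^ 16)
    (hdeg : ∀ a, u a ≠ 0 → 1 / z ^ 40 < nbr G (restr ν Y) a) : False := by
  have hz0 : 0 < z := by linarith
  have hz1 : 1 ≤ z := by linarith
  set K : V → Finset V := fun a => nbhdIn G Y a with hK
  set d : V → ℝ := fun a => ∑ y ∈ K a, ν y with hd
  set ov : V → V → ℝ := fun a b => ∑ y ∈ K a ∩ K b, ν y with hov
  have hdK : ∀ a, nbr G (restr ν Y) a = d a := fun a => nbr_restr ν Y a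
  have hd0 : ∀ a, u a ≠ 0 → 1 / z ^ 40 < d a := fun a ha => (hdK a) ▸ hdeg a ha
  have hdpos : ∀ a, u a ≠ 0 → 0 < d a := fun a ha => lt_trans (by positivity) (hd0 a ha)
  have hov0 : ∀ a b, 0 ≤ ov a b := fun a b => Finset.sum_nonneg fun y _ => hν y
  have hovc : ∀ a b, ov a b = ov b a := fun a b => by simp only [hov, Finset.inter_comm]
  set M : ℕ := ⌈z⌉₊ with hM
  have hM1 : z ≤ M := Nat.le_ceil z
  have hM2 : (M : ℝ) ≤ 2 * z := by
    have := Nat.ceil_lt_add_one hz0.le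
    linarith
  have hM0 : (0 : ℝ) < M := by linarith
  -- A random `b` rarely covers a sizeable part of the neighbourhood of `a`.
  have hmean : ∀ a, ∑ b, u b * ov a b ≤ d a * (1 / z ^ 16) := by
    intro a
    have h1 : ∑ b, u b * ov a b = ∑ y ∈ K a, ν y * nbr G u y := by
      rw [← edgeWt_restr, edgeWt_comm, edgeWt]
      refine Finset.sum_congr rfl fun b _ => ?_
      rw [nbr_restr]
      congr 1
      refine Finset.sum_congr ?_ fun _ _ => rfl
      ext y
      simp only [hK, Finset.mem_inter, mem_nbhdIn, Finset.mem_filter]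
      tauto
    rw [h1, hd, Finset.sum_mul]
    exact Finset.sum_le_sum fun y hy =>
      mul_le_mul_of_nonneg_left (huY y (mem_nbhdIn.1 hy).1) (hν y)
  have hrare : ∀ a, u a ≠ 0 → ∑ b with d a / (2 * M) < ov a b, u b ≤ 2 * M / z ^ 16 := by
    intro a ha
    have h1 := markov (T := d a / (2 * M)) hu.nonneg (hov0 a) Finset.univ (hmean a)
    have h2 := hdpos a ha
    rw [← le_div_iff₀ (by positivity)] at h1
    refine h1.trans (le_of_eq ?_)
    field_simp
  set R2 : V → V → Prop := fun a b => d a / (2 * M) < ov a b with hR2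
  have hR2w : ∑ a, u a * ∑ b with R2 a b, u b ≤ 2 * M / z ^ 16 := by
    calc ∑ a, u a * ∑ b with R2 a b, u b ≤ ∑ a, u a * (2 * M / z ^ 16) := by
          refine Finset.sum_le_sum fun a _ => ?_
          by_cases ha : u a = 0
          · simp [ha]
          · exact mul_le_mul_of_nonneg_left (hrare a ha) (hu.nonneg a)
      _ = 2 * M / z ^ 16 := by rw [← Finset.sum_mul, hu.sum, one_mul]
  have hR2w' : ∑ a, u a * ∑ b with R2 b a, u b ≤ 2 * M / z ^ 16 := by
    refine le_trans (le_of_eq ?_) hR2w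
    simp only [Finset.sum_filter, Finset.mul_sum]
    rw [Finset.sum_comm]
    refine Finset.sum_congr rfl fun a _ => Finset.sum_congr rfl fun b _ => ?_
    split_ifs <;> ring
  set R : V → V → Prop := fun a b => G.Adj a b ∨ R2 a b ∨ R2 b a with hR
  have hRw : ∑ a, u a * ∑ b with R a b, u b ≤ 40 / z ^ 13 := by
    have h1 : ∑ a, u a * ∑ b with R a b, u b ≤
        edgeWt G u u + ∑ a, u a * ∑ b with R2 a b, u b + ∑ a, u a * ∑ b with R2 b a, u b := by
      rw [edgeWt, ← Finset.sum_add_distrib, ← Finset.sum_add_distrib]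
      refine Finset.sum_le_sum fun a _ => ?_
      rw [← mul_add, ← mul_add]
      refine mul_le_mul_of_nonneg_left ?_ (hu.nonneg a)
      simp only [nbr, Finset.sum_filter]
      rw [← Finset.sum_add_distrib, ← Finset.sum_add_distrib]
      refine Finset.sum_le_sum fun b _ => ?_
      have := hu.nonneg b
      by_cases q1 : G.Adj a b <;> by_cases q2 : R2 a b <;> by_cases q3 : R2 b a <;>
        simp [hR, q1, q2, q3] <;> linarith
    have h2 : s * z ^ 5 ≤ 32 / z ^ 13 := by
      calc s * z ^ 5 ≤ 32 / z ^ 18 * z ^ 5 := mul_le_mul_of_nonneg_right hs.le (by positivity)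
        _ = 32 / z ^ 13 := by field_simp
    have h3 : 2 * M / z ^ 16 ≤ 4 / z ^ 13 := by
      rw [div_le_div_iff₀ (by positivity) (by positivity)]
      have e : z ^ 16 = z ^ 13 * z ^ 3 := by ring
      have e' : z ≤ z ^ 3 := le_self_pow₀ hz1 (by norm_num)
      rw [e]
      nlinarith [pow_pos hz0 13]
    have h4 : 32 / z ^ 13 + 4 / z ^ 13 + 4 / z ^ 13 = 40 / z ^ 13 := by ring
    linarith
  obtain ⟨A, hAM, hA0, hAR⟩ := exists_conflict_free hu R
    (fun a b hab => by
      rcases hab with hab | hab | hab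
      · exact Or.inl hab.symm
      · exact Or.inr (Or.inr hab)
      · exact Or.inr (Or.inl hab))
    (fun a ha => Or.inr (Or.inl (by
      have h1 := hdpos a ha
      have h2 : ov a a = d a := by simp only [hov, hd, Finset.inter_self]
      rw [hR2]
      simp only [h2]
      exact div_lt_self h1 (by linarith))))
    (by positivity : (0 : ℝ) < 40 / z ^ 13) (by convert hRw) M (by
      rw [mul_div_assoc', div_le_one (by positivity)]
      have e : z ^ 13 = z * z ^ 12 := by ring
      have e' : (64 : ℝ) ^ 12 ≤ z ^ 12 := by gcongr
      rw [e]
      nlinarith)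
  set B : V → Finset V := fun a => K a \ (A.erase a).biUnion K with hB
  have hBK : ∀ a, B a ⊆ K a := fun a => Finset.sdiff_subset
  have hKY : ∀ a, K a ⊆ Y := fun a => Finset.filter_subset _ _
  -- Private neighbourhoods keep at least half of the degree.
  have hBν : ∀ a ∈ A, d a / 2 ≤ ∑ y ∈ B a, ν y := by
    intro a ha
    have h1 : ∑ y ∈ B a, ν y + ∑ y ∈ K a ∩ (A.erase a).biUnion K, ν y = d a := by
      rw [hB, hd]
      simp only
      rw [add_comm]
      exact Finset.sum_inter_add_sum_sdiff (K a) _ ν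
    have h2 : ∑ y ∈ K a ∩ (A.erase a).biUnion K, ν y ≤ d a / 2 := by
      have e : K a ∩ (A.erase a).biUnion K = (A.erase a).biUnion fun b => K a ∩ K b := by
        ext y; simp only [Finset.mem_inter, Finset.mem_biUnion]; tauto
      rw [e]
      refine (sum_biUnion_le hν _ _).trans ?_
      have h3 : ∀ b ∈ A.erase a, ∑ y ∈ K a ∩ K b, ν y ≤ d a / (2 * M) := by
        intro b hb
        obtain ⟨hba, hbA⟩ := Finset.mem_erase.1 hb
        by_contra hlt
        exact hAR a ha b hbA hba.symm (Or.inr (Or.inl (not_le.1 hlt)))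
      refine (Finset.sum_le_card_nsmul _ _ _ h3).trans ?_
      rw [nsmul_eq_mul]
      have h4 : ((A.erase a).card : ℝ) ≤ M := by
        rw [← hAM]; exact_mod_cast Finset.card_le_card (Finset.erase_subset _ _)
      have h5 := (hdpos a (hA0 a ha)).le
      calc ((A.erase a).card : ℝ) * (d a / (2 * M)) ≤ M * (d a / (2 * M)) :=
            mul_le_mul_of_nonneg_right h4 (by positivity)
        _ = d a / 2 := by field_simp
    linarith
  have hAne : A.Nonempty := by
    rw [← Finset.card_pos, hAM]; exact_mod_cast hM0
  refine h.no_anticomplete hΛ (B := B) hAne (fun a _ => (hBK a).trans ((hKY a).trans hYS))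
    ?_ ?_ ?_ ?_
  · intro a ha
    refine Finset.card_lt_card ⟨(hBK a).trans ((hKY a).trans hYS), fun hsub => ?_⟩
    have h1 := hsub (hXS (hu.mem (hA0 a ha)))
    exact G.loopless.irrefl a (mem_nbhdIn.1 (hBK a h1)).2
  · rw [hAM]
    have h1 : s * M ≤ 32 / z ^ 18 * (2 * z) := mul_le_mul hs.le hM2 hM0.le (by positivity)
    refine h1.trans ?_
    rw [div_mul_eq_mul_div, div_le_one (by positivity)]
    have e : z ^ 18 = z * z ^ 17 := by ring
    have e' : (64 : ℝ) ^ 17 ≤ z ^ 17 := by gcongr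
    rw [e]
    nlinarith
  · intro a ha
    rw [hAM]
    have hcard : ∑ y ∈ B a, ν y ≤ (B a).card * (z ^ (20 * D) / S.card) :=
      sum_le_card_mul (fun y => (le_div_iff₀ h.card_pos).2 (hνb y)) (B a)
    have h1 := hBν a ha
    have h2 := hd0 a (hA0 a ha)
    have h3 : 1 / z ^ 40 / 2 ≤ (B a).card * z ^ (20 * D) / S.card := by
      rw [← mul_div_assoc] at hcard
      linarith
    rw [div_div, div_le_div_iff₀ (by positivity) h.card_pos, one_mul] at h3
    have h4 : (z ^ 40 * 2) * z ^ (20 * D) ≤ (M : ℝ) ^ C := by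
      calc (z ^ 40 * 2) * z ^ (20 * D) ≤ (z ^ 40 * z ^ 2) * z ^ (20 * D) := by
            gcongr; nlinarith
        _ = z ^ (42 + 20 * D) := by ring
        _ ≤ z ^ C := pow_le_pow_right₀ hz1 hC
        _ ≤ (M : ℝ) ^ C := by gcongr
    nlinarith [Nat.cast_nonneg (α := ℝ) (B a).card]
  · intro a ha b hb hab x hx y hy hxy
    have hxK := mem_nbhdIn.1 (hBK a hx)
    have hyK := mem_nbhdIn.1 (hBK b hy)
    have hpriv : ∀ {p q r : V}, q ∈ A → p ≠ q → r ∈ B p → ¬ G.Adj q r := by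
      intro p q r hq hpq hr hqr
      refine (Finset.mem_sdiff.1 hr).2
        (Finset.mem_biUnion.2 ⟨q, Finset.mem_erase.2 ⟨hpq.symm, hq⟩, ?_⟩)
      exact mem_nbhdIn.2 ⟨hKY p (hBK p hr), hqr⟩
    have hva := hX a (hu.mem (hA0 a ha))
    have hvb := hX b (hu.mem (hA0 b hb))
    exact hG v a x y b hva hxK.2 hxy hyK.2.symm hvb.symm (hY x hxK.1) (hY y hyK.1)
      (hpriv ha hab.symm hy) (fun hadj => hAR a ha b hb hab (Or.inl hadj))
      (fun hadj => hpriv hb hab hx hadj.symm)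

end

/-! ### Trimming and iterated sparsification -/

section

open scoped Classical

variable {V : Type*} [Fintype V] {G : SimpleGraph V} {C : ℕ} {Λ : ℝ} {S : Finset V} {s t : ℝ}

/-- In a critical set, a sparse weight `w` on neighbours of `v` whose degrees into a set `Y` of
non-neighbours of `v` are small can be trimmed so that almost every vertex of `Y` sees at most
`s / 32` of it. The degree bound is squared again and again: if many vertices violated the next
bound, they would give a comb. -/
lemma Critical.exists_trim (h : Critical G C Λ S s t) (hΛ : 0 < Λ) (hG : NoFiveHole G) {D : ℕ}
    (hC : 42 + 20 * D ≤ C) {z₀ : ℝ} (hz₀ : 64 ≤ z₀) {ν : V → ℝ}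
    (hν : ∀ a, 0 ≤ ν a) (hνb : ∀ a, ν a * S.card ≤ z₀ ^ (20 * D)) {v : V} {X Y : Finset V}
    (hXS : X ⊆ S) (hX : ∀ a ∈ X, G.Adj v a) (hYS : Y ⊆ S) (hY : ∀ y ∈ Y, ¬ G.Adj v y) {w : V → ℝ}
    (hw : ProbOn w X) (hwE : edgeWt G w w ≤ s * z₀)
    (hdeg : ∀ a ∈ X, nbr G (restr ν Y) a ≤ 1 / z₀ ^ 20) :
    ∃ w' : V → ℝ, (∀ a, 0 ≤ w' a) ∧ (∀ a, w' a ≤ w a) ∧ 1 / 2 ≤ ∑ a, w' a ∧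
      ∃ Y' ⊆ Y, ∑ y ∈ Y, ν y - 2 / z₀ ^ 2 ≤ ∑ y ∈ Y', ν y ∧ ∀ y ∈ Y', nbr G w' y ≤ s / 32 := by
  by_contra hno
  have hz₀0 : 0 < z₀ := by linarith
  -- Deleting the vertices of `Y'` that see much of `w'` costs little, by double counting; if `s`
  -- were not small compared with the degrees, this would already be the desired pair.
  have trim : ∀ z, z₀ ≤ z → ∀ w' : V → ℝ, (∀ a, 0 ≤ w' a) → (∀ a, w' a ≤ w a) →
      1 / 2 + 2 / z ^ 2 ≤ ∑ a, w' a → ∀ Y' ⊆ Y,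
      ∑ y ∈ Y, ν y - 2 / z₀ ^ 2 + 2 / z ^ 2 ≤ ∑ y ∈ Y', ν y →
      (∀ a, w' a ≠ 0 → nbr G (restr ν Y') a ≤ 1 / z ^ 20) →
      s < 32 / z ^ 18 ∧ ∃ Y'' ⊆ Y', ∑ y ∈ Y, ν y - 2 / z₀ ^ 2 + 1 / z ^ 2 ≤ ∑ y ∈ Y'', ν y ∧
        ∀ y ∈ Y'', nbr G w' y ≤ 1 / z ^ 18 := by
    intro z hz w' hw0 hww hmass Y' hY' hνY' hdeg'
    have hz0 : 0 < z := by linarith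
    have hcount : ∑ y ∈ Y', ν y * nbr G w' y ≤ 1 / z ^ 20 := by
      rw [← edgeWt_restr, edgeWt_comm]
      refine (edgeWt_le hw0 hdeg').trans (mul_le_of_le_one_left (by positivity) ?_)
      exact (Finset.sum_le_sum fun a _ => hww a).trans hw.sum.le
    have hbad := markov (T := 1 / z ^ 18) hν (nbr_nonneg hw0) Y' hcount
    have hbad' : ∑ y ∈ Y' with 1 / z ^ 18 < nbr G w' y, ν y ≤ 1 / z ^ 2 := by
      rw [← le_div_iff₀ (by positivity)] at hbad
      refine hbad.trans (le_of_eq ?_)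
      field_simp
    have hsplit := Finset.sum_filter_add_sum_filter_not Y' (fun y => 1 / z ^ 18 < nbr G w' y) ν
    have hY'' : ∑ y ∈ Y, ν y - 2 / z₀ ^ 2 + 1 / z ^ 2 ≤
        ∑ y ∈ Y' with ¬ 1 / z ^ 18 < nbr G w' y, ν y := by
      have e : 2 / z ^ 2 = 1 / z ^ 2 + 1 / z ^ 2 := by ring
      linarith
    have hnbr : ∀ y ∈ ({y ∈ Y' | ¬ 1 / z ^ 18 < nbr G w' y} : Finset V),
        nbr G w' y ≤ 1 / z ^ 18 := fun y hy => not_lt.1 (Finset.mem_filter.1 hy).2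
    refine ⟨?_, _, Finset.filter_subset _ _, hY'', hnbr⟩
    by_contra hs
    have hs' : 1 / z ^ 18 ≤ s / 32 := by
      have e : 32 / z ^ 18 = 32 * (1 / z ^ 18) := by ring
      linarith [not_lt.1 hs]
    refine hno ⟨w', hw0, hww, ?_, _, (Finset.filter_subset _ _).trans hY', ?_,
      fun y hy => (hnbr y hy).trans hs'⟩
    · have : 0 ≤ 2 / z ^ 2 := by positivity
      linarith
    · have : 0 ≤ 1 / z ^ 2 := by positivity
      linarith
  -- The degree bounds that can be reached are arbitrarily small.
  have stage : ∀ j : ℕ, ∃ z, z₀ ≤ z ∧ (j : ℝ) ≤ z ∧ ∃ w' : V → ℝ, (∀ a, 0 ≤ w' a) ∧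
      (∀ a, w' a ≤ w a) ∧ 1 / 2 + 2 / z ^ 2 ≤ ∑ a, w' a ∧ ∃ Y' ⊆ Y,
      ∑ y ∈ Y, ν y - 2 / z₀ ^ 2 + 2 / z ^ 2 ≤ ∑ y ∈ Y', ν y ∧
      (∀ a, w' a ≠ 0 → nbr G (restr ν Y') a ≤ 1 / z ^ 20) := by
    intro j
    induction j with
    | zero =>
      refine ⟨z₀, le_rfl, by simpa using hz₀0.le, w, hw.nonneg, fun _ => le_rfl, ?_, Y, subset_rfl,
        by linarith, fun a ha => hdeg a (hw.mem ha)⟩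
      rw [hw.sum]
      have : 2 / z₀ ^ 2 ≤ 1 / 2 := by
        rw [div_le_div_iff₀ (by positivity) (by norm_num)]
        nlinarith
      linarith
    | succ j ih =>
      obtain ⟨z, hz, hjz, w', hw0, hww, hmass, Y', hY', hνY', hdeg'⟩ := ih
      have hz0 : 0 < z := by linarith
      have hz64 : 64 ≤ z := by linarith
      obtain ⟨hs, Y'', hY'', hνY'', hnbr⟩ := trim z hz w' hw0 hww hmass Y' hY' hνY' hdeg'
      set H : Finset V := {a | 1 / z ^ 40 < nbr G (restr ν Y'') a} with hH
      have hsq : 2 / (z ^ 2) ^ 2 ≤ 1 / z ^ 2 := by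
        rw [div_le_div_iff₀ (by positivity) (by positivity)]
        have h1 : 2 ≤ z ^ 2 := by nlinarith
        nlinarith
      have hHsum : ∑ a ∈ H, w' a < 1 / z ^ 2 := by
        by_contra hge
        have hge := not_lt.1 hge
        have hm : 1 / z ^ 2 ≤ ∑ a, restr w' H a := by rwa [sum_restr]
        have hm0 : 0 < ∑ a, restr w' H a := lt_of_lt_of_le (by positivity) hm
        set c : ℝ := (∑ a, restr w' H a)⁻¹ with hc
        have hc0 : 0 ≤ c := inv_nonneg.2 hm0.le
        have hcz : c ≤ z ^ 2 := by
          rw [hc]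
          refine inv_le_of_inv_le₀ (by positivity) ?_
          rwa [← one_div]
        have hru : ProbOn (fun a => c * restr w' H a) X := by
          refine probOn_normalize (restr_nonneg hw0) (fun a ha => ?_) hm0
          have h1 := hww a
          rw [hw.zero a ha] at h1
          exact le_antisymm ((restr_le hw0 a).trans h1) (restr_nonneg hw0 a)
        refine h.no_comb hΛ hG hC hz64 hs hν
          (fun a => (hνb a).trans (pow_le_pow_left₀ hz₀0.le hz _)) hXS hX
          ((hY''.trans hY').trans hYS) (fun y hy => hY y (hY' (hY'' hy))) hru ?_ ?_ ?_
        · rw [edgeWt_mul_mul]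
          have h1 : edgeWt G (restr w' H) (restr w' H) ≤ s * z :=
            (edgeWt_mono (restr_nonneg hw0) (restr_nonneg hw0)
              (fun a => (restr_le hw0 a).trans (hww a))
              fun a => (restr_le hw0 a).trans (hww a)).trans
              (hwE.trans (mul_le_mul_of_nonneg_left hz h.s_pos.le))
          calc c ^ 2 * edgeWt G (restr w' H) (restr w' H) ≤ (z ^ 2) ^ 2 * (s * z) := by
                refine mul_le_mul (pow_le_pow_left₀ hc0 hcz 2) h1 ?_ (by positivity)
                exact Finset.sum_nonneg fun a _ => mul_nonneg (restr_nonneg hw0 a)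
                  (nbr_nonneg (restr_nonneg hw0) a)
            _ = s * z ^ 5 := by ring
        · intro y hy
          rw [nbr_mul]
          calc c * nbr G (restr w' H) y ≤ z ^ 2 * (1 / z ^ 18) :=
                mul_le_mul hcz ((nbr_mono (restr_le hw0) y).trans (hnbr y hy))
                  (nbr_nonneg (restr_nonneg hw0) y) (by positivity)
            _ = 1 / z ^ 16 := by field_simp
        · intro a ha
          have h1 := (restr_ne_zero (right_ne_zero_of_mul ha)).1
          rw [hH, Finset.mem_filter] at h1
          exact h1.2
      refine ⟨z ^ 2, by nlinarith, by push_cast; nlinarith, restr w' (Finset.univ \ H),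
        restr_nonneg hw0, fun a => (restr_le hw0 a).trans (hww a), ?_, Y'', hY''.trans hY',
        by linarith, fun a ha => ?_⟩
      · rw [sum_restr]
        have h1 := Finset.sum_sdiff (f := w') (Finset.subset_univ H)
        have e : 2 / z ^ 2 = 1 / z ^ 2 + 1 / z ^ 2 := by ring
        linarith
      · have h1 := (restr_ne_zero ha).1
        rw [Finset.mem_sdiff, hH, Finset.mem_filter, not_and] at h1
        rw [← pow_mul]
        exact not_lt.1 (h1.2 h1.1)
  obtain ⟨j, hj⟩ := exists_nat_gt (32 / s)
  obtain ⟨z, hz1, hz2, w', h1, h2, h3, Y', hY', h4, h5⟩ := stage j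
  have hz0 : 0 < z := by linarith
  refine absurd (trim z hz1 w' h1 h2 h3 Y' hY' h4 h5).1 (not_lt.2 ?_)
  have e : z ≤ z ^ 18 := le_self_pow₀ (by linarith) (by norm_num)
  have hs := h.s_pos
  rw [div_lt_iff₀ hs] at hj
  rw [div_le_iff₀ (by positivity)]
  nlinarith

/-- `ν` is a probability weight on `S` in which every vertex sees at most `1 / z ^ 20`, and which is
at most a fixed power of `z` times the uniform weight. -/
structure IsSparseWeight (G : SimpleGraph V) (D : ℕ) (S : Finset V) (z : ℝ) (ν : V → ℝ) :
    Prop where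
  prob : ProbOn ν S
  le : ∀ a, ν a * S.card ≤ z ^ (20 * D)
  nbr_le : ∀ a, ν a ≠ 0 → nbr G ν a ≤ 1 / z ^ 20

/-- A sparse weight on a critical set can be made sparser. Otherwise every set `U` carrying half of
it has a vertex `v` with large neighbourhood in `U`. Trimming a weight on this neighbourhood and
deleting from `U` the few vertices that see much of the result, again and again, gives about `8 * z`
weights with few edges between them; their average is too sparse for a critical set. -/
lemma Critical.exists_sparser (h : Critical G C Λ S s t) (hΛ : 0 < Λ) (hG : NoFiveHole G) {D : ℕ}
    (hD : 1 ≤ D) (hC : 42 + 20 * D ≤ C) {z : ℝ} (hz : 64 ≤ z) (hsz : s * z ^ 20 ≤ 1) {ν : V → ℝ}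
    (hν : IsSparseWeight G D S z ν) : ∃ ν', IsSparseWeight G D S (z ^ 2) ν' := by
  by_contra hno
  have hz0 : 0 < z := by linarith
  have hz1 : 1 ≤ z := by linarith
  have hs := h.s_pos
  set κ := cap C Λ S s t with hκ
  have hκ0 : 0 < κ := div_pos hΛ h.den_pos
  have round : ∀ j : ℕ, (j : ℝ) ≤ 9 * z → ∃ U : Finset V, (∀ a ∈ U, ν a ≠ 0) ∧
      1 - j * (3 / z ^ 2) ≤ ∑ a ∈ U, ν a ∧ ∃ w : V → ℝ, (∀ a, 0 ≤ w a) ∧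
      (∀ a, a ∉ S → w a = 0) ∧ ∑ a, w a = j ∧ (∀ a, w a ≤ j * κ) ∧
      edgeWt G w w ≤ j * (4 * (s * z)) + j ^ 2 * (s / 16) ∧
      ∀ y ∈ U, nbr G w y ≤ j * (s / 16) := by
    intro j
    induction j with
    | zero =>
      intro _
      refine ⟨Finset.univ.filter fun a => ν a ≠ 0, by simp, ?_, fun _ => 0,
        by simp [edgeWt, nbr]⟩
      rw [Finset.sum_filter_ne_zero, hν.prob.sum]
      simp
    | succ j ih =>
      intro hj
      push_cast at hj ⊢
      obtain ⟨U, hUν, hU, w, hw0, hwS, hwsum, hwκ, hwE, hwU⟩ := ih (by linarith)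
      have hU2 : 1 / 2 ≤ ∑ a ∈ U, ν a := by
        have : (j : ℝ) * (3 / z ^ 2) ≤ 1 / 2 := by
          rw [mul_div_assoc', div_le_iff₀ (by positivity)]
          nlinarith
        linarith
      have hUS : U ⊆ S := fun a ha => hν.prob.mem (hUν a ha)
      obtain ⟨v, hv, hvdeg⟩ : ∃ v ∈ U, 1 / (2 * z ^ 40) < nbr G (restr ν U) v := by
        by_contra hlow
        push Not at hlow
        have hm0 : 0 < ∑ a, restr ν U a := by rw [sum_restr]; linarith
        have hinv : (∑ a, restr ν U a)⁻¹ ≤ 2 := by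
          refine inv_le_of_inv_le₀ (by norm_num) ?_
          rw [sum_restr]; linarith
        refine hno ⟨_, probOn_normalize (restr_nonneg hν.prob.nonneg) (fun a ha => ?_) hm0,
          fun a => ?_, fun a ha => ?_⟩
        · by_contra h0
          exact ha (hUS (restr_ne_zero h0).1)
        · have h1 := (restr_le (Y := U) hν.prob.nonneg a)
          have h2 := restr_nonneg (Y := U) hν.prob.nonneg a
          have h3 := hν.le a
          have h4 : (2 : ℝ) ≤ z ^ (20 * D) :=
            le_trans (by linarith) (le_self_pow₀ hz1 (by omega))
          calc (∑ a, restr ν U a)⁻¹ * restr ν U a * S.card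
              ≤ 2 * ν a * S.card :=
                mul_le_mul_of_nonneg_right (mul_le_mul hinv h1 h2 (by norm_num)) h.card_pos.le
            _ = 2 * (ν a * S.card) := by ring
            _ ≤ z ^ (20 * D) * z ^ (20 * D) :=
                mul_le_mul h4 h3 (mul_nonneg (hν.prob.nonneg a) h.card_pos.le) (by positivity)
            _ = (z ^ 2) ^ (20 * D) := by ring
        · rw [nbr_mul]
          have h1 := hlow a (restr_ne_zero (right_ne_zero_of_mul ha)).1
          calc (∑ a, restr ν U a)⁻¹ * nbr G (restr ν U) a ≤ 2 * (1 / (2 * z ^ 40)) :=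
                mul_le_mul hinv h1 (nbr_nonneg (restr_nonneg hν.prob.nonneg) a) (by norm_num)
            _ = 1 / (z ^ 2) ^ 20 := by rw [← pow_mul]; field_simp
      set X := nbhdIn G U v with hX
      set Y : Finset V := {y ∈ U | ¬ G.Adj v y} with hY
      have hXU : X ⊆ U := Finset.filter_subset _ _
      have hYU : Y ⊆ U := Finset.filter_subset _ _
      have hXν : ∑ a ∈ X, ν a = nbr G (restr ν U) v := (nbr_restr ν U v).symm
      have hsplit : ∑ a ∈ X, ν a + ∑ a ∈ Y, ν a = ∑ a ∈ U, ν a :=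
        Finset.sum_filter_add_sum_filter_not U (fun y => G.Adj v y) ν
      have hXle : ∑ a ∈ X, ν a ≤ 1 / z ^ 20 := by
        rw [hXν]
        exact (nbr_mono (restr_le hν.prob.nonneg) v).trans (hν.nbr_le v (hUν v hv))
      have hXc : 2 * (S.card : ℝ) ≤ z ^ C * X.card := by
        have h1 : ∑ a ∈ X, ν a ≤ X.card * (z ^ (20 * D) / S.card) :=
          sum_le_card_mul (fun a => (le_div_iff₀ h.card_pos).2 (hν.le a)) X
        rw [hXν] at h1
        have h2 := hvdeg.le.trans h1
        rw [mul_div_assoc', div_le_div_iff₀ (by positivity) h.card_pos, one_mul] at h2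
        have h3 : 2 * (z ^ (20 * D) * (2 * z ^ 40)) ≤ z ^ C := by
          calc 2 * (z ^ (20 * D) * (2 * z ^ 40)) = 4 * (z ^ (20 * D) * z ^ 40) := by ring
            _ ≤ z ^ 2 * (z ^ (20 * D) * z ^ 40) := by gcongr; nlinarith
            _ = z ^ (42 + 20 * D) := by ring
            _ ≤ z ^ C := pow_le_pow_right₀ hz1 hC
        have h4 := mul_le_mul_of_nonneg_right h3 (Nat.cast_nonneg (α := ℝ) X.card)
        linarith
      have hXS : X.card < S.card := by
        refine Finset.card_lt_card ⟨hXU.trans hUS, fun hsub => ?_⟩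
        exact G.loopless.irrefl v (mem_nbhdIn.1 (hsub (hUS hv))).2
      have hsz1 : s * z ≤ 1 :=
        le_trans (mul_le_mul_of_nonneg_left (le_self_pow₀ hz1 (by norm_num)) hs.le) hsz
      obtain ⟨w₁, hw₁, hw₁κ, hw₁E⟩ := h.exists_weight hΛ (hXU.trans hUS) hXS hz0 hsz1
        one_le_two hXc
      obtain ⟨w', hw'0, hw'w, hw'sum, Y', hY', hY'ν, hY'w⟩ := h.exists_trim hΛ hG hC hz
        hν.prob.nonneg hν.le (hXU.trans hUS) (fun a ha => (mem_nbhdIn.1 ha).2) (hYU.trans hUS)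
        (fun y hy => (Finset.mem_filter.1 hy).2) hw₁ hw₁E
        (fun a ha => (nbr_mono (restr_le hν.prob.nonneg) a).trans (hν.nbr_le a (hUν a (hXU ha))))
      have hm0 : 0 < ∑ a, w' a := by linarith
      have hinv : (∑ a, w' a)⁻¹ ≤ 2 := inv_le_of_inv_le₀ (by norm_num) (by linarith)
      have hinv0 : 0 ≤ (∑ a, w' a)⁻¹ := inv_nonneg.2 hm0.le
      have hw2 : ProbOn (fun a => (∑ a, w' a)⁻¹ * w' a) X :=
        probOn_normalize hw'0 (fun a ha => le_antisymm
          ((hw'w a).trans_eq (hw₁.zero a ha)) (hw'0 a)) hm0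
      have hw2E : edgeWt G (fun a => (∑ a, w' a)⁻¹ * w' a) (fun a => (∑ a, w' a)⁻¹ * w' a) ≤
          4 * (s * z) := by
        rw [edgeWt_mul_mul]
        have h1 := (edgeWt_mono hw'0 hw'0 hw'w hw'w).trans hw₁E
        have h2 : (∑ a, w' a)⁻¹ ^ 2 ≤ 4 := by nlinarith
        exact mul_le_mul h2 h1 (Finset.sum_nonneg fun a _ =>
          mul_nonneg (hw'0 a) (nbr_nonneg hw'0 a)) (by norm_num)
      have hw2κ : ∀ a, (∑ a, w' a)⁻¹ * w' a ≤ κ := fun a => by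
        calc (∑ a, w' a)⁻¹ * w' a ≤ 2 * (κ / 2) :=
              mul_le_mul hinv ((hw'w a).trans (hw₁κ a)) (hw'0 a) (by norm_num)
          _ = κ := by ring
      have hw2Y : ∀ y ∈ Y', nbr G (fun a => (∑ a, w' a)⁻¹ * w' a) y ≤ s / 16 := fun y hy => by
        rw [nbr_mul]
        calc (∑ a, w' a)⁻¹ * nbr G w' y ≤ 2 * (s / 32) :=
              mul_le_mul hinv (hY'w y hy) (nbr_nonneg hw'0 y) (by norm_num)
          _ = s / 16 := by ring
      set w₂ : V → ℝ := fun a => (∑ a, w' a)⁻¹ * w' a with hw₂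
      have hcross : edgeWt G w₂ w ≤ j * (s / 16) := by
        refine (edgeWt_le hw2.nonneg fun a ha => hwU a (hXU (hw2.mem ha))).trans ?_
        rw [hw2.sum, one_mul]
      refine ⟨Y', fun a ha => hUν a (hYU (hY' ha)), ?_, fun a => w a + w₂ a,
        fun a => add_nonneg (hw0 a) (hw2.nonneg a),
        fun a ha => by
          simp only [hwS a ha, (hw2.mono (hXU.trans hUS)).zero a ha, add_zero], ?_,
        fun a => ?_, ?_, fun y hy => ?_⟩
      · have e : 1 / z ^ 20 ≤ 1 / z ^ 2 :=
          one_div_le_one_div_of_le (by positivity) (pow_le_pow_right₀ hz1 (by norm_num))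
        have e2 : ((j : ℝ) + 1) * (3 / z ^ 2) = j * (3 / z ^ 2) + 2 / z ^ 2 + 1 / z ^ 2 := by ring
        linarith
      · rw [Finset.sum_add_distrib, hwsum, hw2.sum]
      · linarith [hwκ a, hw2κ a]
      · rw [edgeWt_add_self]
        have e : ((j : ℝ) + 1) ^ 2 * (s / 16) = j ^ 2 * (s / 16) + 2 * (j * (s / 16)) + s / 16 := by
          ring
        linarith
      · rw [nbr_add]
        linarith [hwU y (hYU (hY' hy)), hw2Y y hy]
  set r : ℕ := ⌈8 * z⌉₊ with hr
  have hr1 : 8 * z ≤ r := Nat.le_ceil _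
  have hr2 : (r : ℝ) ≤ 9 * z := by
    have := Nat.ceil_lt_add_one (by positivity : 0 ≤ 8 * z)
    linarith
  have hr0 : (0 : ℝ) < r := by linarith
  obtain ⟨U, -, -, w, hw0, hwS, hwsum, hwκ, hwE, -⟩ := round r hr2
  have hprob : ProbOn (fun a => (r : ℝ)⁻¹ * w a) S := by
    have := probOn_normalize hw0 hwS (by rw [hwsum]; exact hr0)
    rwa [hwsum] at this
  have hlt := (h.lt_edgeWt hprob fun a => (inv_mul_le_iff₀ hr0).2 (hwκ a)).1
  rw [edgeWt_mul_mul, inv_pow, inv_mul_eq_div, lt_div_iff₀ (by positivity)] at hlt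
  nlinarith [mul_le_mul_of_nonneg_left hr1 (mul_pos hs hr0).le, mul_pos hs (pow_pos hr0 2)]

/-- A critical set carries no sparse weight: it could be made sparser until the edges have weight at
most `s`. -/
lemma Critical.not_isSparseWeight (h : Critical G C Λ S s t) (hG : NoFiveHole G) {D : ℕ}
    (hD : 1 ≤ D) (hC : 42 + 20 * D ≤ C) (hΛ : (64 : ℝ) ^ (20 * D) ≤ Λ) {ν : V → ℝ}
    (hν : IsSparseWeight G D S 64 ν) : False := by
  have hΛ0 : 0 < Λ := lt_of_lt_of_le (by positivity) hΛ
  have hs := h.s_pos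
  have ht := h.t_pos
  have hst : s * t ≤ 1 := mul_le_one₀ h.s_le ht.le h.t_le
  have bound : ∀ z : ℝ, 64 ≤ z → z ^ (20 * D) * (s * t) ^ C ≤ Λ → ∀ ν,
      IsSparseWeight G D S z ν → s * z ^ 20 ≤ 1 := by
    intro z hz hzΛ ν hν
    by_contra hlt
    have hlt := not_le.1 hlt
    refine absurd (h.lt_edgeWt hν.prob fun a => ?_).1 (not_lt.2 ?_)
    · rw [cap, le_div_iff₀ h.den_pos]
      calc ν a * ((s * t) ^ C * S.card) = ν a * S.card * (s * t) ^ C := by ring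
        _ ≤ z ^ (20 * D) * (s * t) ^ C := mul_le_mul_of_nonneg_right (hν.le a) (by positivity)
        _ ≤ Λ := hzΛ
    · refine (edgeWt_le hν.prob.nonneg hν.nbr_le).trans ?_
      rw [hν.prob.sum, one_mul, div_le_iff₀ (by positivity)]
      exact hlt.le
  have step : ∀ j : ℕ, ∃ z : ℝ, 64 ≤ z ∧ (j : ℝ) ≤ z ∧ z ^ (20 * D) * (s * t) ^ C ≤ Λ ∧
      ∃ ν, IsSparseWeight G D S z ν := by
    intro j
    induction j with
    | zero =>
      refine ⟨64, le_rfl, by norm_num, ?_, ν, hν⟩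
      exact (mul_le_of_le_one_right (by positivity) (pow_le_one₀ (by positivity) hst)).trans hΛ
    | succ j ih =>
      obtain ⟨z, hz, hjz, hzΛ, ν, hν⟩ := ih
      have hz0 : 0 < z := by linarith
      have hsz := bound z hz hzΛ ν hν
      obtain ⟨ν', hν'⟩ := h.exists_sparser hΛ0 hG hD hC hz hsz hν
      refine ⟨z ^ 2, by nlinarith, by push_cast; nlinarith, ?_, ν', hν'⟩
      have h1 : (s * t) ^ C ≤ s ^ (2 * D) := by
        calc (s * t) ^ C ≤ s ^ C :=
              pow_le_pow_left₀ (by positivity) (mul_le_of_le_one_right hs.le h.t_le) C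
          _ ≤ s ^ (2 * D) := pow_le_pow_of_le_one hs.le h.s_le (by omega)
      calc (z ^ 2) ^ (20 * D) * (s * t) ^ C ≤ (z ^ 2) ^ (20 * D) * s ^ (2 * D) :=
            mul_le_mul_of_nonneg_left h1 (by positivity)
        _ = (s * z ^ 20) ^ (2 * D) := by ring
        _ ≤ 1 := pow_le_one₀ (by positivity) hsz
        _ ≤ 64 ^ (20 * D) := one_le_pow₀ (by norm_num)
        _ ≤ Λ := hΛ
  obtain ⟨j, hj⟩ := exists_nat_gt (1 / s)
  obtain ⟨z, hz, hjz, hzΛ, ν', hν'⟩ := step j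
  have hsz := bound z hz hzΛ ν' hν'
  have e : z ≤ z ^ 20 := le_self_pow₀ (by linarith) (by norm_num)
  rw [div_lt_iff₀ hs] at hj
  nlinarith

end

/-! ### The polynomial form of Rödl's theorem and the Erdős–Hajnal property -/

section

open scoped Classical

/-- Restricting a weight with few edges to the vertices of small degree makes all degrees small. -/
lemma exists_isSparseWeight {V : Type*} [Fintype V] {G : SimpleGraph V} {D : ℕ} {M : ℝ}
    (hM : 2 * M ≤ 64 ^ (20 * D)) {S : Finset V} {w : V → ℝ} (hw : ProbOn w S)
    (hwM : ∀ a, w a * S.card ≤ M) (hE : edgeWt G w w ≤ 1 / (4 * 64 ^ 20)) :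
    ∃ ν, IsSparseWeight G D S 64 ν := by
  set Z : Finset V := {a | ¬ 2 * (1 / (4 * 64 ^ 20)) < nbr G w a} with hZ
  have h1 := markov (T := 2 * (1 / (4 * 64 ^ 20))) hw.nonneg (nbr_nonneg hw.nonneg) Finset.univ hE
  have h2 : ∑ a with 2 * (1 / (4 * 64 ^ 20)) < nbr G w a, w a + ∑ a ∈ Z, w a = 1 := by
    refine Eq.trans ?_ hw.sum
    convert Finset.sum_filter_add_sum_filter_not Finset.univ
      (fun a => 2 * (1 / (4 * 64 ^ 20)) < nbr G w a) w
  have hmass : 1 / 2 ≤ ∑ a, restr w Z a := by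
    rw [sum_restr]
    have h3 : ∑ a with 2 * (1 / (4 * 64 ^ 20)) < nbr G w a, w a ≤ 1 / 2 := by
      rw [← le_div_iff₀ (by norm_num)] at h1
      refine h1.trans (le_of_eq (by norm_num))
    linarith
  have hm0 : 0 < ∑ a, restr w Z a := by linarith
  have hinv : (∑ a, restr w Z a)⁻¹ ≤ 2 := inv_le_of_inv_le₀ (by norm_num) (by linarith)
  have hinv0 : 0 ≤ (∑ a, restr w Z a)⁻¹ := inv_nonneg.2 hm0.le
  refine ⟨_, probOn_normalize (restr_nonneg hw.nonneg) (fun a ha => ?_) hm0, fun a => ?_,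
    fun a ha => ?_⟩
  · by_contra h0
    exact ha (hw.mem (restr_ne_zero h0).2)
  · calc (∑ a, restr w Z a)⁻¹ * restr w Z a * S.card ≤ 2 * w a * S.card :=
          mul_le_mul_of_nonneg_right (mul_le_mul hinv (restr_le hw.nonneg a)
            (restr_nonneg hw.nonneg a) (by norm_num)) (Nat.cast_nonneg _)
      _ = 2 * (w a * S.card) := by ring
      _ ≤ 2 * M := by linarith [hwM a]
      _ ≤ _ := hM
  · rw [nbr_mul]
    have h4 := (restr_ne_zero (right_ne_zero_of_mul ha)).1
    rw [hZ, Finset.mem_filter, not_lt] at h4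
    calc (∑ a, restr w Z a)⁻¹ * nbr G (restr w Z) a ≤ 2 * (2 * (1 / (4 * 64 ^ 20))) :=
          mul_le_mul hinv ((nbr_mono (restr_le hw.nonneg) a).trans h4.2)
            (nbr_nonneg (restr_nonneg hw.nonneg) a) (by norm_num)
      _ = 1 / 64 ^ 20 := by norm_num

end

/-- The polynomial form of Rödl's theorem for graphs without induced five-cycles. -/
theorem exists_hasWeight : ∃ C : ℕ, ∃ Λ : ℝ, 1 ≤ C ∧ 0 < Λ ∧
    ∀ (V : Type u) [Fintype V] (G : SimpleGraph V), NoFiveHole G → ∀ S : Finset V, S.Nonempty →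
      ∀ s t : ℝ, 0 < s → s ≤ 1 → 0 < t → t ≤ 1 → HasWeight G C Λ S s t := by
  obtain ⟨M, hM⟩ := exists_sparse_or_cosparse.{u} (by norm_num : (0 : ℝ) < 1 / (4 * 64 ^ 20))
  obtain ⟨D, hD⟩ := pow_unbounded_of_one_lt (2 * M) (by norm_num : (1 : ℝ) < 64)
  have hD' : 2 * M ≤ 64 ^ (20 * (D + 1)) :=
    hD.le.trans (pow_le_pow_right₀ (by norm_num) (by omega))
  refine ⟨42 + 20 * (D + 1), 64 ^ (20 * (D + 1)), by omega, by positivity, ?_⟩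
  intro V _ G hG S
  induction hn : S.card using Nat.strong_induction_on generalizing S with
  | _ n ih =>
    intro hS s t hs hs1 ht ht1
    by_contra hfail
    have hcrit : Critical G (42 + 20 * (D + 1)) (64 ^ (20 * (D + 1))) S s t :=
      ⟨hs, hs1, ht, ht1, hS, fun T _ hT hTS s' t' h1 h2 h3 h4 =>
        ih T.card (hn ▸ hTS) T rfl hT s' t' h1 h2 h3 h4, hfail⟩
    obtain ⟨w, hw, hwM, hwE | hwE⟩ := hM V G hG S hS
    · obtain ⟨ν, hν⟩ := exists_isSparseWeight hD' hw hwM hwE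
      exact hcrit.not_isSparseWeight hG (by omega) le_rfl le_rfl hν
    · obtain ⟨ν, hν⟩ := exists_isSparseWeight hD' hw hwM hwE
      exact hcrit.compl.not_isSparseWeight hG.compl (by omega) le_rfl le_rfl hν

section

open scoped Classical

/-- A sparse weight that is nowhere large yields a large stable set. -/
lemma exists_stable {V : Type*} [Fintype V] {H : SimpleGraph V} {S : Finset V} {w : V → ℝ}
    (hw : ProbOn w S) {c σ : ℝ} (hσ : 0 < c + σ) (hc : ∀ a, w a ≤ c) (hE : edgeWt H w w ≤ σ)
    {M : ℕ} (hM : 4 * M * (c + σ) ≤ 1) :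
    ∃ A : Finset V, A.card = M ∧ ∀ a ∈ A, ∀ b ∈ A, a ≠ b → ¬ H.Adj a b := by
  set R : V → V → Prop := fun a b => a = b ∨ H.Adj a b with hR
  have h3 : ∀ a, ∑ b with R a b, w b ≤ c + nbr H w a := by
    intro a
    calc ∑ b with R a b, w b
        ≤ ∑ b, ((if a = b then w b else 0) + if H.Adj a b then w b else 0) := by
          rw [Finset.sum_filter]
          refine Finset.sum_le_sum fun b _ => ?_
          by_cases q1 : a = b <;> by_cases q2 : H.Adj a b <;> simp [hR, q1, q2]
      _ = w a + nbr H w a := by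
          rw [Finset.sum_add_distrib, nbr]
          simp
      _ ≤ c + nbr H w a := by linarith [hc a]
  have h4 : ∑ a, w a * ∑ b with R a b, w b ≤ c + σ := by
    calc ∑ a, w a * ∑ b with R a b, w b ≤ ∑ a, w a * (c + nbr H w a) :=
          Finset.sum_le_sum fun a _ => mul_le_mul_of_nonneg_left (h3 a) (hw.nonneg a)
      _ = c + edgeWt H w w := by
          simp only [mul_add, Finset.sum_add_distrib, ← Finset.sum_mul, hw.sum, one_mul, edgeWt]
      _ ≤ c + σ := by linarith
  obtain ⟨A, h1, -, h2⟩ := exists_conflict_free hw R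
    (fun a b h => h.imp Eq.symm SimpleGraph.Adj.symm) (fun a _ => Or.inl rfl) hσ
    (by convert h4) M hM
  exact ⟨A, h1, fun a ha b hb hab hadj => h2 a ha b hb hab (Or.inr hadj)⟩

end

end FiveHole

theorem theorem1p4 :
    ∃ τ : ℝ, 0 < τ ∧
      ∀ (V : Type*) [Fintype V] (G : SimpleGraph V),
        ¬ (SimpleGraph.cycleGraph 5).IsIndContained G →
          (Fintype.card V : ℝ) ^ τ ≤ ((max G.indepNum G.cliqueNum : ℕ) : ℝ) := by
  obtain ⟨C, Λ, hC, hΛ, hmain⟩ := FiveHole.exists_hasWeight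
  have hC0 : (0 : ℝ) < C := by exact_mod_cast hC
  set K : ℝ := 8 * (1 + Λ) with hK
  have hK8 : 8 ≤ K := by linarith
  refine ⟨1 / (8 * C * K), by positivity, ?_⟩
  intro V _ G hG
  -- A set that is stable in `G` or in the complement bounds the maximum from below.
  have hmax : ∀ A : Finset V, ((∀ a ∈ A, ∀ b ∈ A, a ≠ b → ¬ G.Adj a b) ∨
      (∀ a ∈ A, ∀ b ∈ A, a ≠ b → ¬ Gᶜ.Adj a b)) → A.card ≤ max G.indepNum G.cliqueNum := by
    rintro A (hA | hA)
    · refine le_max_of_le_left (SimpleGraph.IsIndepSet.card_le_indepNum ?_)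
      exact fun a ha b hb hab => hA a ha b hb hab
    · have hcl : G.IsClique (A : Set V) := by
        intro a ha b hb hab
        by_contra hadj
        exact hA a ha b hb hab ((SimpleGraph.compl_adj _ _ _).2 ⟨hab, hadj⟩)
      exact le_max_of_le_right hcl.card_le_cliqueNum
  set n : ℕ := Fintype.card V with hn
  rcases Nat.eq_zero_or_pos n with h0 | hnpos
  · rw [h0, Nat.cast_zero, Real.zero_rpow (by positivity)]
    positivity
  have hnR : (1 : ℝ) ≤ n := by exact_mod_cast hnpos
  have hV : (Finset.univ : Finset V).Nonempty := by
    rw [← Finset.card_pos, Finset.card_univ]; exact hnpos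
  set x : ℝ := (n : ℝ) ^ (1 / (4 * C) : ℝ) with hx
  have hx1 : 1 ≤ x := Real.one_le_rpow hnR (by positivity)
  have hx0 : 0 < x := by linarith
  have hxn : x ^ (4 * C) = n := by
    rw [hx, ← Real.rpow_natCast, ← Real.rpow_mul (by positivity)]
    push_cast
    rw [one_div_mul_cancel (by positivity), Real.rpow_one]
  rcases le_or_gt (K ^ 2) x with hKx | hKx
  · obtain ⟨w, hw, hwb, hwE⟩ := hmain V G (FiveHole.noFiveHole_of_not_isIndContained hG)
      Finset.univ hV (1 / x) (1 / x) (by positivity) (by rw [div_le_one hx0]; exact hx1)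
      (by positivity) (by rw [div_le_one hx0]; exact hx1)
    have hwc : ∀ a, w a ≤ Λ / x := by
      intro a
      have h1 := hwb a
      rw [Finset.card_univ, ← hn, ← hxn] at h1
      have h2 : (1 / x * (1 / x)) ^ C * x ^ (4 * C) = x ^ (2 * C) := by
        rw [show 4 * C = 2 * C + 2 * C by ring, pow_add, pow_mul, ← mul_assoc, ← mul_pow]
        field_simp
        simp
      rw [h2] at h1
      rw [le_div_iff₀ hx0]
      refine le_trans (mul_le_mul_of_nonneg_left ?_ (hw.nonneg a)) h1
      exact le_self_pow₀ hx1 (by omega)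
    set M : ℕ := ⌊x / (4 * (1 + Λ))⌋₊ with hM
    have hM1 : (M : ℝ) ≤ x / (4 * (1 + Λ)) := Nat.floor_le (by positivity)
    have hM4 : 4 * (M : ℝ) * (Λ / x + 1 / x) ≤ 1 := by
      rw [← add_div, mul_div_assoc', div_le_one hx0]
      rw [le_div_iff₀ (by positivity)] at hM1
      linarith
    have hMx : (n : ℝ) ^ (1 / (8 * C * K) : ℝ) ≤ M := by
      have h1 : x / (4 * (1 + Λ)) < M + 1 := Nat.lt_floor_add_one _
      have h2 : (n : ℝ) ^ (1 / (8 * C * K) : ℝ) ≤ Real.sqrt x := by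
        rw [Real.sqrt_eq_rpow, hx, ← Real.rpow_mul (by positivity)]
        refine Real.rpow_le_rpow_of_exponent_le hnR ?_
        rw [div_mul_div_comm, one_mul]
        refine one_div_le_one_div_of_le (by positivity) ?_
        nlinarith
      have h3 : Real.sqrt x * Real.sqrt x = x := Real.mul_self_sqrt hx0.le
      have h4 : K ≤ Real.sqrt x := Real.le_sqrt_of_sq_le hKx
      have h5 : x / (4 * (1 + Λ)) = 2 * x / K := by rw [hK]; field_simp; norm_num
      rw [h5, div_lt_iff₀ (by linarith)] at h1
      nlinarith
    obtain ⟨A, hAM, hA⟩ : ∃ A : Finset V, A.card = M ∧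
        ((∀ a ∈ A, ∀ b ∈ A, a ≠ b → ¬ G.Adj a b) ∨
          (∀ a ∈ A, ∀ b ∈ A, a ≠ b → ¬ Gᶜ.Adj a b)) := by
      rcases hwE with hwE | hwE
      · obtain ⟨A, h1, h2⟩ := FiveHole.exists_stable hw (by positivity) hwc hwE hM4
        exact ⟨A, h1, Or.inl h2⟩
      · obtain ⟨A, h1, h2⟩ := FiveHole.exists_stable hw (by positivity) hwc hwE hM4
        exact ⟨A, h1, Or.inr h2⟩
    refine hMx.trans ?_
    rw [← hAM]
    exact_mod_cast hmax A hA
  · -- Here `n` is bounded, and the exponent is so small that `n ^ τ ≤ 2`.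
    rcases Nat.lt_or_ge 1 n with h2 | h1
    · have hle : (n : ℝ) ^ (1 / (8 * C * K) : ℝ) ≤ 2 := by
        have h3 : (n : ℝ) ^ (1 / (8 * C * K) : ℝ) = x ^ (1 / (2 * K)) := by
          rw [hx, ← Real.rpow_mul (by positivity)]
          congr 1
          field_simp
          norm_num
        have h4 : x ^ (1 / (2 * K)) ≤ (K ^ 2) ^ (1 / (2 * K)) :=
          Real.rpow_le_rpow hx0.le hKx.le (by positivity)
        have h5 : (K ^ 2) ^ (1 / (2 * K)) = K ^ (1 / K) := by
          rw [← Real.rpow_natCast, ← Real.rpow_mul (by positivity)]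
          congr 1
          field_simp
          norm_num
        have h6 : K ≤ 2 ^ K := by
          have := one_add_mul_self_le_rpow_one_add (by norm_num : (-1 : ℝ) ≤ 1)
            (by linarith : (1 : ℝ) ≤ K)
          norm_num at this
          linarith
        have h7 : K ^ (1 / K) ≤ ((2 : ℝ) ^ K) ^ (1 / K) :=
          Real.rpow_le_rpow (by linarith) h6 (by positivity)
        rw [← Real.rpow_mul (by norm_num), mul_one_div_cancel (by linarith), Real.rpow_one] at h7
        linarith
      refine hle.trans ?_
      classical
      obtain ⟨a, b, hab⟩ := Fintype.exists_pair_of_one_lt_card h2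
      have hcard : ({a, b} : Finset V).card = 2 := Finset.card_pair hab
      have : 2 ≤ max G.indepNum G.cliqueNum := by
        rw [← hcard]
        refine hmax _ ?_
        by_cases hadj : G.Adj a b
        · right
          simp [hadj, hadj.symm]
        · left
          simp [hadj, G.adj_comm b a]
      exact_mod_cast this
    · have hn1 : n = 1 := by omega
      rw [hn1, Nat.cast_one, Real.one_rpow]
      obtain ⟨a, -⟩ := hV
      have := hmax {a} (Or.inl (by simp))
      exact_mod_cast this
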